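/- Let $F$ be a field (of any characteristic, finite or infinite). By an $F$-algebra we mean a unital, not necessarily associative algebra over $F$. With $(x,y,z)=(xy)z-x(yz)$, the nucleus of $A$ is $N(A)=\{x\in A : (x,A,A)=(A,x,A)=(A,A,x)=0\}$, an associative algebra; the center of $A$ is the set of elements of $N(A)$ commuting with all of $A$; and $A$ is $F$-central if $A\neq 0$ and its center is $F\cdot 1$. An étale $F$-algebra is a finite direct product of finite separable field extensions of $F$. A module is minimally faithful if it is faithful and no section of it (quotient $Q/P$ of submodules $P\subseteq Q$), other than the module itself, is faithful. An $F$-algebra $A$ is semiassociative if it is finite dimensional, $F$-central, and there is an étale (unital) $F$-subalgebra $K\subseteq N(A)$ such that $A$ is minimally faithful as a module over $K\otimes_F K$ via $(k\otimes k')a=kak'$. For $n\ge 1$ and scalars $c_{ijk}\in F$ $(1\le i,j,k\le n)$ with $c_{iij}=c_{jii}=1$ for all $i,j$, the skew matrix algebra $M_n(F;c)$ is the $F$-algebra with basis $e_{ij}$ $(1\le i,j\le n)$ and multiplication $e_{ij}e_{k\ell}=\delta_{jk}c_{ij\ell}e_{i\ell}$. A field extension $E/F$, algebraic or not, is called separable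 if $\overline F\otimes_F E$ is reduced, where $\overline F$ is an algebraic closure of $F$; for algebraic extensions this is the usual notion. Let $A$ be an $F$-algebra. 1. If $E\otimes_F A$ is a semiassociative $E$-algebra for some separable field extension $E/F$, then $A$ is a semiassociative $F$-algebra. 2. $A$ is semiassociative if and only if it is a form of skew matrices, that is, there is a separable field extension $E/F$ such that $E\otimes_F A$ is isomorphic, as an $E$-algebra, to a skew matrix algebra $M_n(E;c)$ for some $n\geq 1$ and some $c$ as above. This equivalence also holds with "separable field extension" replaced by "separable algebraic field extension", and with it replaced by "finite separable field extension". -/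

import Mathlib

open scoped TensorProduct

universe u v w

/-! A (unital, not necessarily associative) algebra `A` over a field `F` is given by
`[NonAssocRing A] [Module F A] [SMulCommClass F A A] [IsScalarTower F A A]`. -/

namespace Semiassoc

section Nucleus

variable (F : Type u) [Field F] (A : Type v) [NonAssocRing A] [Module F A]
  [SMulCommClass F A A] [IsScalarTower F A A]

/-- The nucleus of `A`: the intersection of the left, middle and right nuclei. -/
def nucleus : Submodule F A where
  carrier := {x | (∀ a b : A, associator x a b = 0) ∧ (∀ a b : A, associator a x b = 0) ∧
    (∀ a b : A, associator a b x = 0)}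
  zero_mem' := by simp [associator]
  add_mem' := by
    rintro x y ⟨hx₁, hx₂, hx₃⟩ ⟨hy₁, hy₂, hy₃⟩
    simp only [associator, sub_eq_zero] at *
    refine ⟨fun a b => ?_, fun a b => ?_, fun a b => ?_⟩
    · simp only [add_mul, hx₁, hy₁]
    · simp only [add_mul, mul_add, hx₂, hy₂]
    · simp only [mul_add, hx₃, hy₃]
  smul_mem' := by
    rintro r x ⟨hx₁, hx₂, hx₃⟩
    simp only [associator, sub_eq_zero] at *
    refine ⟨fun a b => ?_, fun a b => ?_, fun a b => ?_⟩
    · simp only [smul_mul_assoc, hx₁]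
    · simp only [smul_mul_assoc, mul_smul_comm, hx₂]
    · simp only [mul_smul_comm, hx₃]

variable {F A}

theorem mem_nucleus_iff {x : A} : x ∈ nucleus F A ↔
    (∀ a b : A, (x * a) * b = x * (a * b)) ∧ (∀ a b : A, (a * x) * b = a * (x * b)) ∧
    (∀ a b : A, (a * b) * x = a * (b * x)) := by
  simp only [← sub_eq_zero (b := _ * (_ * _))]
  exact Iff.rfl

theorem nucleus_left (x : nucleus F A) (a b : A) : ((x : A) * a) * b = x * (a * b) :=
  (mem_nucleus_iff.1 x.2).1 a b

theorem nucleus_mid (x : nucleus F A) (a b : A) : (a * (x : A)) * b = a * (x * b) :=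
  (mem_nucleus_iff.1 x.2).2.1 a b

theorem nucleus_right (x : nucleus F A) (a b : A) : (a * b) * (x : A) = a * (b * x) :=
  (mem_nucleus_iff.1 x.2).2.2 a b

theorem one_mem_nucleus : (1 : A) ∈ nucleus F A := by
  rw [mem_nucleus_iff]; simp

theorem mul_mem_nucleus {x y : A} (hx : x ∈ nucleus F A) (hy : y ∈ nucleus F A) :
    x * y ∈ nucleus F A := by
  rw [mem_nucleus_iff] at *
  obtain ⟨hx₁, hx₂, hx₃⟩ := hx
  obtain ⟨hy₁, hy₂, hy₃⟩ := hy
  refine ⟨fun a b => ?_, fun a b => ?_, fun a b => ?_⟩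
  · rw [hx₁, hx₁, hx₁, hy₁]
  · rw [← hx₂, hy₂, hx₂, hx₁]
  · rw [← hx₂, ← hx₂, ← hy₃, hx₃]

instance : Mul (nucleus F A) := ⟨fun x y => ⟨x * y, mul_mem_nucleus x.2 y.2⟩⟩

instance : One (nucleus F A) := ⟨⟨1, one_mem_nucleus⟩⟩

theorem nucleus_coe_mul (x y : nucleus F A) : ((x * y : nucleus F A) : A) = x * y := rfl

theorem nucleus_coe_one : ((1 : nucleus F A) : A) = 1 := rfl

/-- The nucleus is an associative ring under the operations of `A`. -/
instance : Ring (nucleus F A) :=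
  { (inferInstance : AddCommGroup (nucleus F A)),
    (inferInstance : Mul (nucleus F A)), (inferInstance : One (nucleus F A)) with
    left_distrib := fun x y z => Subtype.ext (mul_add (x : A) y z)
    right_distrib := fun x y z => Subtype.ext (add_mul (x : A) y z)
    zero_mul := fun x => Subtype.ext (zero_mul (x : A))
    mul_zero := fun x => Subtype.ext (mul_zero (x : A))
    mul_assoc := fun x y z => Subtype.ext (nucleus_left x (y : A) z)
    one_mul := fun x => Subtype.ext (one_mul (x : A))
    mul_one := fun x => Subtype.ext (mul_one (x : A)) }

/-- The nucleus is an associative `F`-algebra, with the scalar action inherited from `A`. -/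
instance : Algebra F (nucleus F A) :=
  Algebra.ofModule (fun r x y => Subtype.ext (smul_mul_assoc r (x : A) y))
    (fun r x y => Subtype.ext (mul_smul_comm r (x : A) y))

end Nucleus

section BiAction

variable {F : Type u} [Field F] {A : Type v} [NonAssocRing A] [Module F A]
  [SMulCommClass F A A] [IsScalarTower F A A]

/-- Left multiplication by elements of a subalgebra of the nucleus. -/
def leftAction (K : Subalgebra F (nucleus F A)) : K →ₐ[F] Module.End F A :=
  AlgHom.ofLinearMap
    ((LinearMap.mul F A) ∘ₗ (nucleus F A).subtype ∘ₗ K.val.toLinearMap)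
    (LinearMap.ext fun a => one_mul a)
    (fun x _ => LinearMap.ext fun a => nucleus_left (x : nucleus F A) _ a)

/-- Right multiplication by elements of a commutative subalgebra of the nucleus. -/
def rightAction (K : Subalgebra F (nucleus F A)) [IsMulCommutative K] :
    K →ₐ[F] Module.End F A :=
  AlgHom.ofLinearMap
    ((LinearMap.mul F A).flip ∘ₗ (nucleus F A).subtype ∘ₗ K.val.toLinearMap)
    (LinearMap.ext fun a => mul_one a)
    (fun x y => LinearMap.ext fun a => by
      have h : x * y = y * x := mul_comm' x y
      rw [h]
      exact (nucleus_right (x : nucleus F A) a ((y : nucleus F A) : A)).symm)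

open scoped IsMulCommutative in
/-- The action of `K ⊗ K` on `A` given by `(k ⊗ k') a = k a k'`, for a commutative subalgebra `K`
of the nucleus of `A`. -/
noncomputable def biAction (K : Subalgebra F (nucleus F A)) [IsMulCommutative K] :
    K ⊗[F] K →ₐ[F] Module.End F A :=
  Algebra.TensorProduct.lift (leftAction K) (rightAction K)
    (fun x _ => LinearMap.ext fun a => (nucleus_left (x : nucleus F A) a _).symm)

theorem biAction_tmul (K : Subalgebra F (nucleus F A)) [IsMulCommutative K] (k k' : K) (a : A) :
    biAction K (k ⊗ₜ[F] k') a = ((k : nucleus F A) : A) * a * ((k' : nucleus F A) : A) :=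
  (nucleus_left (k : nucleus F A) a _).symm

end BiAction

/-- A module is minimally faithful if it is faithful and none of its sections (quotients `Q / P`
of submodules `P ≤ Q`), other than the module itself, is faithful. -/
def IsMinimallyFaithful (R : Type u) (M : Type v) [Ring R] [AddCommGroup M] [Module R M] : Prop :=
  FaithfulSMul R M ∧
    ∀ P Q : Submodule R M, P ≤ Q → FaithfulSMul R (Q ⧸ P.submoduleOf Q) → P = ⊥ ∧ Q = ⊤

section Semiassociative

variable (F : Type u) [Field F] (A : Type v) [NonAssocRing A] [Module F A]
  [SMulCommClass F A A] [IsScalarTower F A A]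

/-- `A` is `F`-central: `F` embeds in `A`, and its image is the whole center of `A`
(the elements that associate and commute with everything). -/
def IsCentralAlgebra : Prop :=
  Nontrivial A ∧ Set.center A = Set.range (fun r : F => r • (1 : A))

open scoped IsMulCommutative in
/-- `A` is semiassociative: it is finite dimensional, `F`-central, and minimally faithful over
`K ⊗ K` for some étale `F`-subalgebra `K` of its nucleus. -/
def IsSemiassociative : Prop :=
  FiniteDimensional F A ∧ IsCentralAlgebra F A ∧
    ∃ (K : Subalgebra F (nucleus F A)) (_ : IsMulCommutative K),
      Algebra.Etale F K ∧
      @IsMinimallyFaithful (K ⊗[F] K) A _ _ (Module.compHom A (biAction K).toRingHom)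

end Semiassociative

/-- A reduced skew set of degree `n`: scalars `c i j k` with `c i i j = c j i i = 1`. -/
structure ReducedSkewSet (F : Type u) [Field F] (n : ℕ) where
  coeff : Fin n → Fin n → Fin n → F
  left_one : ∀ i j, coeff i i j = 1
  right_one : ∀ i j, coeff j i i = 1

/-- The skew matrix algebra `M_n(F; c)`. An element is the array of its coordinates with respect
to the matrix units. -/
def SkewMatrix {F : Type u} [Field F] {n : ℕ} (_c : ReducedSkewSet F n) : Type u :=
  Fin n → Fin n → F

namespace SkewMatrix

variable {F : Type u} [Field F] {n : ℕ} (c : ReducedSkewSet F n)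

instance : AddCommGroup (SkewMatrix c) := inferInstanceAs (AddCommGroup (Fin n → Fin n → F))

instance : Module F (SkewMatrix c) := inferInstanceAs (Module F (Fin n → Fin n → F))

instance : Mul (SkewMatrix c) := ⟨fun x y i l => ∑ j, c.coeff i j l * (x i j * y j l)⟩

instance : One (SkewMatrix c) := ⟨fun i j => if i = j then 1 else 0⟩

variable {c}

theorem mul_apply (x y : SkewMatrix c) (i l : Fin n) :
    (x * y) i l = ∑ j, c.coeff i j l * (x i j * y j l) := rfl

theorem one_apply (i j : Fin n) : (1 : SkewMatrix c) i j = if i = j then 1 else 0 := rfl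

theorem add_apply (x y : SkewMatrix c) (i j : Fin n) : (x + y) i j = x i j + y i j := rfl

theorem zero_apply (i j : Fin n) : (0 : SkewMatrix c) i j = 0 := rfl

theorem smul_apply (r : F) (x : SkewMatrix c) (i j : Fin n) : (r • x) i j = r * x i j := rfl

@[ext]
theorem ext {x y : SkewMatrix c} (h : ∀ i j, x i j = y i j) : x = y :=
  funext fun i => funext fun j => h i j

instance : NonAssocRing (SkewMatrix c) :=
  { (inferInstance : AddCommGroup (SkewMatrix c)),
    (inferInstance : Mul (SkewMatrix c)), (inferInstance : One (SkewMatrix c)) with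
    left_distrib := fun x y z => by
      ext i l; simp only [mul_apply, add_apply, mul_add, Finset.sum_add_distrib]
    right_distrib := fun x y z => by
      ext i l; simp only [mul_apply, add_apply, mul_add, add_mul, Finset.sum_add_distrib]
    zero_mul := fun x => by
      ext i l; simp only [mul_apply, zero_apply, zero_mul, mul_zero, Finset.sum_const_zero]
    mul_zero := fun x => by
      ext i l; simp only [mul_apply, zero_apply, mul_zero, Finset.sum_const_zero]
    one_mul := fun x => by
      ext i l; simp [mul_apply, one_apply, c.left_one]
    mul_one := fun x => by
      ext i l; simp [mul_apply, one_apply, c.right_one] }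

instance : SMulCommClass F (SkewMatrix c) (SkewMatrix c) := ⟨fun r x y => by
  ext i l
  simp only [smul_eq_mul, mul_apply, smul_apply, Finset.mul_sum]
  exact Finset.sum_congr rfl fun j _ => by ring⟩

instance : IsScalarTower F (SkewMatrix c) (SkewMatrix c) := ⟨fun r x y => by
  ext i l
  simp only [smul_eq_mul, mul_apply, smul_apply, Finset.mul_sum]
  exact Finset.sum_congr rfl fun j _ => by ring⟩

variable (c) in
/-- The matrix unit `e_{ij}`. -/
def single (i j : Fin n) : SkewMatrix c := fun k l => if i = k ∧ j = l then 1 else 0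

/-- The defining multiplication rule `e_{ij} e_{kl} = δ_{jk} c_{ijl} e_{il}`. -/
theorem single_mul_single (i j k l : Fin n) :
    single c i j * single c k l = if j = k then c.coeff i j l • single c i l else 0 := by
  ext p q
  rw [mul_apply, Finset.sum_eq_single j]
  · by_cases hjk : j = k
    · subst hjk
      by_cases hp : i = p
      · by_cases hq : l = q
        · subst hp; subst hq; simp [single, smul_apply]
        · simp [single, smul_apply, hq]
      · simp [single, smul_apply, hp]
    · have hkj : ¬ k = j := fun h => hjk h.symm
      simp [single, zero_apply, hjk, hkj]
  · intro m _ hm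
    have hm' : ¬ j = m := fun h => hm h.symm
    simp [single, hm']
  · simp

end SkewMatrix

section Forms

variable (F : Type u) [Field F] (A : Type v) [NonAssocRing A] [Module F A]

/-- `A` is (isomorphic as an `F`-algebra to) a skew matrix algebra `M_n(F; c)` with `n ≥ 1`. -/
def IsSkewMatrixAlgebra : Prop :=
  ∃ (n : ℕ) (_ : 1 ≤ n) (c : ReducedSkewSet F n) (φ : A ≃ₗ[F] SkewMatrix c),
    ∀ x y : A, φ (x * y) = φ x * φ y

variable [SMulCommClass F A A] [IsScalarTower F A A]

/-- `A` is a form of skew matrices: `E ⊗ A` is a skew matrix algebra over `E` for some separable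
field extension `E / F`. Separable is meant in the general sense, which does not ask `E / F` to be
algebraic: `E` stays reduced after extending scalars to an algebraic closure of `F`. -/
def IsFormOfSkewMatrices : Prop :=
  ∃ (E : Type u) (_ : Field E) (_ : Algebra F E),
    Algebra.IsGeometricallyReduced F E ∧ IsSkewMatrixAlgebra E (E ⊗[F] A)

end Forms

end Semiassoc

/-!
Suppose first that `A` is minimally faithful over `K ⊗ K`. This ring is commutative and semisimple,
so `A` is free of rank one over it. A finite separable extension `E` of `F` splits `K`; the
primitive idempotents of `E ⊗ K` are nuclear idempotents of `E ⊗ A`, and a generator of `A` over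
`K ⊗ K` generates all of their Peirce components, which are therefore lines: `E ⊗ A` is a skew
matrix algebra.

Conversely, let `Ω ⊗ A` be a skew matrix algebra over a separably closed field `Ω`. Let `K` be a
maximal étale subalgebra of the nucleus `N` of `A`, and `C` its centralizer in `N`. Every separable
element of `C` lies in `K`, hence is central in `C`, so that by Jacobson and Noether `C` modulo its
radical is commutative and purely inseparable over `K`. A primitive idempotent of `Ω ⊗ K` thus stays
local in `Ω ⊗ C`, whence it is equivalent in `Ω ⊗ N` to one of the diagonal matrix units `e i i`.
Its Peirce components are then lines as well; so `K ⊗ K` acts faithfully on `A`, and comparing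
dimensions shows that it does so minimally.
-/

namespace Semiassoc

section Nucleus

variable {F : Type u} [Field F] {B : Type v} [NonAssocRing B] [Module F B]
  [SMulCommClass F B B] [IsScalarTower F B B]

theorem nucleus_mul_mul (x y : nucleus F B) (b : B) :
    (x : B) * (y * b) = ((x * y : nucleus F B) : B) * b :=
  (nucleus_left x _ b).symm

theorem mul_nucleus_mul (b : B) (x y : nucleus F B) :
    b * (x : B) * y = b * ((x * y : nucleus F B) : B) :=
  nucleus_right y b _

theorem map_mem_nucleus {B' : Type w} [NonAssocRing B'] [Module F B'] [SMulCommClass F B' B']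
    [IsScalarTower F B' B'] (φ : B ≃ₗ[F] B') (hφ : ∀ x y, φ (x * y) = φ x * φ y)
    (x : nucleus F B) : φ x ∈ nucleus F B' := by
  rw [mem_nucleus_iff]
  refine ⟨fun a b => ?_, fun a b => ?_, fun a b => ?_⟩ <;>
    obtain ⟨a, rfl⟩ := φ.surjective a <;> obtain ⟨b, rfl⟩ := φ.surjective b <;>
    simp only [← hφ, nucleus_left, nucleus_mid, nucleus_right]

/-- The isomorphism of nuclei induced by an isomorphism of algebras. It is stated for a
multiplicative linear equivalence, which automatically preserves the unit. -/
def nucleusMap {B' : Type w} [NonAssocRing B'] [Module F B'] [SMulCommClass F B' B']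
    [IsScalarTower F B' B'] (φ : B ≃ₗ[F] B') (hφ : ∀ x y, φ (x * y) = φ x * φ y) :
    nucleus F B →ₐ[F] nucleus F B' :=
  .ofLinearMap ((φ.toLinearMap ∘ₗ (nucleus F B).subtype).codRestrict _ (map_mem_nucleus φ hφ))
    (Subtype.ext <| show φ 1 = 1 by simpa using (hφ 1 (φ.symm 1)).symm)
    (fun x y => Subtype.ext (hφ x y))

end Nucleus

section Frames

variable {F : Type u} [Field F] {B : Type v} [NonAssocRing B] [Module F B]
  [SMulCommClass F B B] [IsScalarTower F B B] {ι : Type*} [Fintype ι]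

/-- A complete system of orthogonal idempotents `e` of the nucleus all of whose Peirce components
`e i * B * e j` are lines, together with a generator `u i j` of each of them. -/
structure IsFrame (e : ι → nucleus F B) (u : ι → ι → B) : Prop
    extends CompleteOrthogonalIdempotents e where
  ne_zero : ∀ i j, u i j ≠ 0
  left_mul : ∀ i j, (e i : B) * u i j = u i j
  mul_right : ∀ i j, u i j * (e j : B) = u i j
  peirce : ∀ i j x, ∃ r : F, (e i : B) * x * (e j : B) = r • u i j

theorem sum_peirce {e : ι → nucleus F B} (he : ∑ i, e i = 1) (x : B) :
    ∑ i, ∑ j, (e i : B) * x * e j = x := by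
  have he' : ∑ i, (e i : B) = 1 := by
    rw [← nucleus_coe_one (F := F), ← he, Submodule.coe_sum]
  simp_rw [← Finset.mul_sum, he', mul_one, ← Finset.sum_mul, he', one_mul]

namespace IsFrame

variable {e : ι → nucleus F B} {u : ι → ι → B} (h : IsFrame e u)
include h

theorem left_mul_of_ne {i j k : ι} (hki : k ≠ i) : (e k : B) * u i j = 0 := by
  rw [← h.left_mul i j, nucleus_mul_mul, h.ortho hki, ZeroMemClass.coe_zero, zero_mul]

theorem mul_right_of_ne {i j k : ι} (hjk : j ≠ k) : u i j * (e k : B) = 0 := by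
  rw [← h.mul_right i j, mul_nucleus_mul, h.ortho hjk, ZeroMemClass.coe_zero, mul_zero]

theorem mul_of_ne {i j k l : ι} (hjk : j ≠ k) : u i j * u k l = 0 := by
  rw [← h.mul_right i j, nucleus_mid, h.left_mul_of_ne hjk, mul_zero]

theorem exists_mul (i j l : ι) : ∃ r : F, u i j * u j l = r • u i l := by
  obtain ⟨r, hr⟩ := h.peirce i l (u i j * u j l)
  exact ⟨r, by rw [← hr, ← nucleus_left, h.left_mul, nucleus_right, h.mul_right]⟩

theorem linearIndependent : LinearIndependent F fun p : ι × ι => u p.1 p.2 := by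
  classical
  rw [Fintype.linearIndependent_iff]
  rintro m hm ⟨i, j⟩
  have hpeirce (p : ι × ι) :
      (e i : B) * (m p • u p.1 p.2) * e j = if p = (i, j) then m (i, j) • u i j else 0 := by
    rw [mul_smul_comm, smul_mul_assoc]
    split_ifs with hp
    · rw [hp, h.left_mul, h.mul_right]
    · rcases eq_or_ne i p.1 with rfl | hi
      · rw [h.left_mul, h.mul_right_of_ne fun hj => hp (Prod.ext rfl hj), smul_zero]
      · rw [h.left_mul_of_ne hi, zero_mul, smul_zero]
  have := congrArg (fun x => (e i : B) * x * e j) hm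
  simp only [Finset.mul_sum, Finset.sum_mul, hpeirce, Finset.sum_ite_eq', Finset.mem_univ,
    if_true, mul_zero, zero_mul] at this
  exact (smul_eq_zero.1 this).resolve_right (h.ne_zero i j)

/-- The generators of the Peirce components of a frame, as a basis of the algebra. -/
noncomputable def basis : Module.Basis (ι × ι) F B :=
  .mk h.linearIndependent fun x _ => by
    rw [← sum_peirce h.complete x]
    refine sum_mem fun i _ => sum_mem fun j _ => ?_
    obtain ⟨r, hr⟩ := h.peirce i j x
    exact hr ▸ Submodule.smul_mem _ r (Submodule.subset_span ⟨(i, j), rfl⟩)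

theorem basis_apply (p : ι × ι) : h.basis p = u p.1 p.2 := Module.Basis.mk_apply _ _ p

theorem finrank_eq : Module.finrank F B = Fintype.card ι * Fintype.card ι := by
  rw [Module.finrank_eq_card_basis h.basis, Fintype.card_prod]

theorem idempotent_ne_zero (i : ι) : e i ≠ 0 := fun hi => h.ne_zero i i <| by
  rw [← h.left_mul, hi, ZeroMemClass.coe_zero, zero_mul]

theorem normalize [DecidableEq ι] :
    IsFrame e fun i j => if i = j then (e i : B) else u i j where
  __ := h.toCompleteOrthogonalIdempotents
  ne_zero i j := by
    split_ifs
    exacts [by simpa using h.idempotent_ne_zero i, h.ne_zero i j]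
  left_mul i j := by
    split_ifs
    exacts [congrArg Subtype.val (h.idem i), h.left_mul i j]
  mul_right i j := by
    split_ifs with hij
    exacts [hij ▸ congrArg Subtype.val (h.idem i), h.mul_right i j]
  peirce i j x := by
    split_ifs with hij
    · subst hij
      obtain ⟨r, hr⟩ := h.peirce i i x
      obtain ⟨s, hs⟩ := h.peirce i i 1
      rw [mul_one, ← nucleus_coe_mul, h.idem i] at hs
      have hs0 : s ≠ 0 := fun h0 => h.idempotent_ne_zero i <| Subtype.ext <| by simpa [h0] using hs
      exact ⟨r * s⁻¹, by rw [hr, hs, smul_smul, inv_mul_cancel_right₀ hs0]⟩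
    · exact h.peirce i j x

theorem reindex {κ : Type*} [Fintype κ] (σ : κ ≃ ι) :
    IsFrame (e ∘ σ) fun k l => u (σ k) (σ l) where
  __ := (CompleteOrthogonalIdempotents.equiv σ).2 h.toCompleteOrthogonalIdempotents
  ne_zero _ _ := h.ne_zero _ _
  left_mul _ _ := h.left_mul _ _
  mul_right _ _ := h.mul_right _ _
  peirce _ _ := h.peirce _ _

theorem map {B' : Type*} [NonAssocRing B'] [Module F B'] [SMulCommClass F B' B']
    [IsScalarTower F B' B'] (φ : B ≃ₗ[F] B') (hφ : ∀ x y, φ (x * y) = φ x * φ y) :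
    IsFrame (nucleusMap φ hφ ∘ e) fun i j => φ (u i j) where
  __ := h.toCompleteOrthogonalIdempotents.map (nucleusMap φ hφ).toRingHom
  ne_zero i j := by simpa using h.ne_zero i j
  left_mul i j := (hφ _ _).symm.trans (congrArg φ (h.left_mul i j))
  mul_right i j := (hφ _ _).symm.trans (congrArg φ (h.mul_right i j))
  peirce i j x := by
    obtain ⟨x, rfl⟩ := φ.surjective x
    obtain ⟨r, hr⟩ := h.peirce i j x
    exact ⟨r, by rw [← map_smul, ← hr, hφ, hφ]; rfl⟩

theorem exists_eq_smul_one_of_commute (x : B) (hx : ∀ y, x * y = y * x) :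
    ∃ r : F, x = r • (1 : B) := by
  classical
  have hdiag (i) : ∃ r : F, x * e i = r • (e i : B) := by
    obtain ⟨r, hr⟩ := h.normalize.peirce i i x
    simp only [if_true] at hr
    exact ⟨r, by rw [← hr, ← hx, mul_nucleus_mul, h.idem i]⟩
  choose r hr using hdiag
  have hconst (i j) : r i = r j := by
    have hleft : x * u i j = r i • u i j := by
      rw [← h.left_mul i j, ← nucleus_mid, hr, smul_mul_assoc]
    have hright : u i j * x = r j • u i j := by
      rw [← h.mul_right i j, nucleus_mid, ← hx, hr, mul_smul_comm]
    exact smul_left_injective F (h.ne_zero i j) (hleft.symm.trans ((hx _).trans hright))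
  have hone : ∑ i, (e i : B) = 1 := by
    rw [← Submodule.coe_sum, h.complete, nucleus_coe_one]
  have hsum : x = ∑ i, r i • (e i : B) := by
    simp_rw [← hr, ← Finset.mul_sum, hone, mul_one]
  rcases isEmpty_or_nonempty ι with hι | ⟨⟨i₀⟩⟩
  · exact ⟨0, by simp [hsum]⟩
  · exact ⟨r i₀, by rw [hsum, ← hone, Finset.smul_sum]; simp_rw [hconst _ i₀]⟩

/-- Multiplication by nuclear elements `a k`, `b k` transports the Peirce components of the frame
to those of any decomposition into idempotents equivalent to members of the frame. -/
theorem exists_of_equivalent {κ : Type*} [Fintype κ] {f : κ → nucleus F B}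
    (hf : CompleteOrthogonalIdempotents f) (s : κ → ι) (a b : κ → nucleus F B)
    (hab : ∀ k, a k * b k = f k) (hba : ∀ k, b k * a k = e (s k)) :
    ∃ v, IsFrame f v := by
  have hae (k) : f k * a k = a k * e (s k) := by rw [← hba, ← hab, mul_assoc]
  have heb (k) : b k * f k = e (s k) * b k := by rw [← hba, ← hab, mul_assoc]
  have haeb (k) : a k * (e (s k) * b k) = f k := by rw [← heb, ← mul_assoc, hab, hf.idem k]
  refine ⟨fun k l => a k * u (s k) (s l) * b l, hf, fun k l h0 => ?_, fun k l => ?_,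
    fun k l => ?_, fun k l x => ?_⟩
  · apply h.ne_zero (s k) (s l)
    calc u (s k) (s l) = ((b k * a k : nucleus F B) : B) * u (s k) (s l) *
          ((b l * a l : nucleus F B) : B) := by rw [hba, hba, h.left_mul, h.mul_right]
      _ = b k * (a k * u (s k) (s l) * b l) * a l := by
          simp only [← nucleus_mul_mul, ← mul_nucleus_mul, nucleus_left]
      _ = 0 := by rw [h0, mul_zero, zero_mul]
  · rw [← nucleus_left, nucleus_mul_mul, hae, ← nucleus_mul_mul, h.left_mul]
  · rw [mul_nucleus_mul, heb, ← mul_nucleus_mul, nucleus_left, h.mul_right]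
  · obtain ⟨r, hr⟩ := h.peirce (s k) (s l) (b k * x * a l)
    refine ⟨r, ?_⟩
    rw [← smul_mul_assoc, ← mul_smul_comm, ← hr, ← haeb k, ← haeb l]
    simp only [← nucleus_mul_mul, ← mul_nucleus_mul, nucleus_left]

theorem exists_linearEquiv {B' : Type*} [NonAssocRing B'] [Module F B'] [SMulCommClass F B' B']
    [IsScalarTower F B' B'] {e' : ι → nucleus F B'} {u' : ι → ι → B'} (h' : IsFrame e' u')
    {c : ι → ι → ι → F} (hc : ∀ i j l, u i j * u j l = c i j l • u i l)
    (hc' : ∀ i j l, u' i j * u' j l = c i j l • u' i l) :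
    ∃ φ : B ≃ₗ[F] B', ∀ x y, φ (x * y) = φ x * φ y := by
  let φ := h.basis.equiv h'.basis (Equiv.refl _)
  have hφ (i j) : φ (u i j) = u' i j := by
    have := h.basis.equiv_apply (i, j) h'.basis (Equiv.refl _)
    rwa [basis_apply, basis_apply] at this
  refine ⟨φ, LinearMap.congr_fun₂ (f := (LinearMap.mul F B).compr₂ φ.toLinearMap)
    (g := (LinearMap.mul F B').compl₁₂ φ.toLinearMap φ.toLinearMap) ?_⟩
  refine LinearMap.ext_basis h.basis h.basis fun ⟨i, j⟩ ⟨k, l⟩ => ?_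
  suffices φ (u i j * u k l) = φ (u i j) * φ (u k l) by simpa [basis_apply] using this
  rcases eq_or_ne j k with rfl | hjk
  · rw [hc, map_smul, hφ, hφ, hφ, hc']
  · rw [h.mul_of_ne hjk, map_zero, hφ, hφ, h'.mul_of_ne hjk]

end IsFrame

theorem IsFrame.of_finrank_eq {e : ι → nucleus F B} (he : CompleteOrthogonalIdempotents e) (x : B)
    (hx : ∀ i j y, ∃ r : F, (e i : B) * y * e j = r • ((e i : B) * x * e j))
    (hB : Module.finrank F B = Fintype.card ι * Fintype.card ι) :
    IsFrame e fun i j => (e i : B) * x * e j where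
  __ := he
  ne_zero i j := by
    have hspan : ⊤ ≤ Submodule.span F (Set.range fun p : ι × ι => (e p.1 : B) * x * e p.2) := by
      intro y _
      rw [← sum_peirce he.complete y]
      refine sum_mem fun i _ => sum_mem fun j _ => ?_
      obtain ⟨r, hr⟩ := hx i j y
      exact hr ▸ Submodule.smul_mem _ r (Submodule.subset_span ⟨(i, j), rfl⟩)
    exact (linearIndependent_of_top_le_span_of_card_eq_finrank hspan
      (by rw [Fintype.card_prod, hB])).ne_zero (i, j)
  left_mul i j := by rw [← nucleus_left, nucleus_mul_mul, he.idem i]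
  mul_right i j := by rw [mul_nucleus_mul, he.idem j]
  peirce := hx

namespace SkewMatrix

variable {n : ℕ} {c : ReducedSkewSet F n}

theorem single_self_mul_apply (i : Fin n) (x : SkewMatrix c) (k l : Fin n) :
    (single c i i * x) k l = if i = k then x k l else 0 := by
  rw [mul_apply, Finset.sum_eq_single i]
  · by_cases h : i = k
    · subst h; simp [single, c.left_one]
    · simp [single, h]
  · intro m _ hm
    simp [single, hm.symm]
  · simp

theorem mul_single_self_apply (i : Fin n) (x : SkewMatrix c) (k l : Fin n) :
    (x * single c i i) k l = if i = l then x k l else 0 := by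
  rw [mul_apply, Finset.sum_eq_single i]
  · by_cases h : i = l
    · subst h; simp [single, c.right_one]
    · simp [single, h]
  · intro m _ hm
    simp [single, hm.symm]
  · simp

theorem single_self_mem_nucleus (i : Fin n) : single c i i ∈ nucleus F (SkewMatrix c) := by
  rw [mem_nucleus_iff]
  refine ⟨fun a b => ?_, fun a b => ?_, fun a b => ?_⟩ <;> ext k l
  · rw [single_self_mul_apply, mul_apply, mul_apply]
    simp only [single_self_mul_apply]
    split_ifs <;> simp
  · rw [mul_apply, mul_apply]
    simp only [single_self_mul_apply, mul_single_self_apply, mul_ite, ite_mul, mul_zero, zero_mul]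
  · rw [mul_single_self_apply, mul_apply, mul_apply]
    simp only [mul_single_self_apply]
    split_ifs <;> simp

theorem sum_single_self : ∑ i, single c i i = 1 := by
  ext k l
  let entry : SkewMatrix c →+ F := ⟨⟨fun x => x k l, rfl⟩, fun _ _ => rfl⟩
  have hentry : (∑ i, single c i i) k l = ∑ i, single c i i k l :=
    map_sum entry (fun i => single c i i) Finset.univ
  rw [hentry, one_apply]
  simp [single, ite_and]

theorem isFrame (c : ReducedSkewSet F n) :
    IsFrame (fun i => ⟨single c i i, single_self_mem_nucleus i⟩ : Fin n → nucleus F (SkewMatrix c))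
      (single c) where
  idem i := Subtype.ext <| by
    rw [nucleus_coe_mul, single_mul_single, if_pos rfl, c.left_one, one_smul]
  ortho i j hij := Subtype.ext <| by
    rw [nucleus_coe_mul, single_mul_single, if_neg hij, ZeroMemClass.coe_zero]
  complete := Subtype.ext <| by rw [Submodule.coe_sum, nucleus_coe_one, sum_single_self]
  ne_zero i j h0 := by simpa [single, zero_apply] using congrFun (congrFun h0 i) j
  left_mul i j := by rw [single_mul_single, if_pos rfl, c.left_one, one_smul]
  mul_right i j := by rw [single_mul_single, if_pos rfl, c.right_one, one_smul]
  peirce i j x := ⟨x i j, by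
    ext k l
    simp only [mul_single_self_apply, single_self_mul_apply, smul_apply, single]
    split_ifs <;> simp_all⟩

end SkewMatrix

theorem IsFrame.isSkewMatrixAlgebra [Nontrivial B] {e : ι → nucleus F B} {u : ι → ι → B}
    (h : IsFrame e u) : IsSkewMatrixAlgebra F B := by
  classical
  have hι : Nonempty ι := by
    by_contra! hι
    refine one_ne_zero (α := B) ?_
    rw [← nucleus_coe_one (F := F), ← h.complete, Finset.univ_eq_empty, Finset.sum_empty,
      ZeroMemClass.coe_zero]
  have hv := (h.reindex (Fintype.equivFin ι).symm).normalize
  set v : Fin (Fintype.card ι) → Fin (Fintype.card ι) → B := fun i j => if i = j then _ else _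
  choose c hc using hv.exists_mul
  have hone (i) : v i i = _ := if_pos rfl
  let C : ReducedSkewSet F (Fintype.card ι) :=
    { coeff := c
      left_one := fun i j => smul_left_injective F (hv.ne_zero i j) <| by
        change c i i j • v i j = (1 : F) • v i j
        rw [← hc, hone, hv.left_mul, one_smul]
      right_one := fun i j => smul_left_injective F (hv.ne_zero j i) <| by
        change c j i i • v j i = (1 : F) • v j i
        rw [← hc, hone, hv.mul_right, one_smul] }
  exact ⟨_, Fintype.card_pos, C, hv.exists_linearEquiv (SkewMatrix.isFrame C) hc fun i j l => by
    rw [SkewMatrix.single_mul_single, if_pos rfl]⟩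

theorem IsSkewMatrixAlgebra.exists_isFrame (h : IsSkewMatrixAlgebra F B) :
    ∃ (n : ℕ) (_ : 1 ≤ n) (e : Fin n → nucleus F B) (u : Fin n → Fin n → B), IsFrame e u := by
  obtain ⟨n, hn, c, φ, hφ⟩ := h
  exact ⟨n, hn, _, _, (SkewMatrix.isFrame c).map φ.symm fun x y => φ.injective (by simp [hφ])⟩

end Frames

section MinimallyFaithful

theorem exists_torsionOf_eq_bot (R M : Type*) [CommRing R] [IsSemisimpleRing R] [AddCommGroup M]
    [Module R M] [FaithfulSMul R M] : ∃ m : M, Ideal.torsionOf R M m = ⊥ := by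
  obtain ⟨_, ⟨m, rfl⟩, hmin⟩ :=
    wellFounded_lt.has_min (Set.range (Ideal.torsionOf R M)) ⟨_, 0, rfl⟩
  refine ⟨m, by_contra fun hne => ?_⟩
  obtain ⟨e, he, hspan⟩ := IsSemisimpleRing.ideal_eq_span_idempotent (Ideal.torsionOf R M m)
  have hem : e • m = 0 := by
    rw [← Ideal.mem_torsionOf_iff, hspan]
    exact Ideal.mem_span_singleton_self e
  obtain ⟨m', hm'⟩ : ∃ m' : M, e • m' ≠ 0 := by
    by_contra! h
    have he0 : e = 0 := FaithfulSMul.eq_of_smul_eq_smul (α := M) fun x => by rw [h, zero_smul]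
    exact hne (by rw [hspan, he0, Ideal.span_singleton_zero])
  have hee : e • e • m' = e • m' := by rw [smul_smul, he]
  refine hmin _ ⟨m + e • m', rfl⟩ (SetLike.lt_iff_le_and_exists.2 ⟨fun r hr => ?_, e, ?_, ?_⟩)
  · rw [Ideal.mem_torsionOf_iff, smul_add] at hr
    have hrem' : r • e • m' = 0 := by
      simpa only [smul_add, smul_comm e r, hem, hee, smul_zero, zero_add] using
        congrArg (e • ·) hr
    rwa [hrem', add_zero] at hr
  · rwa [Ideal.mem_torsionOf_iff]
  · rwa [Ideal.mem_torsionOf_iff, smul_add, hem, hee, zero_add]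

theorem IsMinimallyFaithful.exists_bijective {R : Type u} [CommRing R] [IsSemisimpleRing R]
    {M : Type v} [AddCommGroup M] [Module R M] (h : IsMinimallyFaithful R M) :
    ∃ m : M, Function.Bijective (LinearMap.toSpanSingleton R M m) := by
  obtain ⟨_, hmin⟩ := h
  obtain ⟨m, hm⟩ := exists_torsionOf_eq_bot R M
  have hinj : Function.Injective (LinearMap.toSpanSingleton R M m) := LinearMap.ker_eq_bot.1 hm
  refine ⟨m, hinj, LinearMap.range_eq_top.1 ?_⟩
  rw [LinearMap.range_toSpanSingleton]
  refine (hmin ⊥ (Submodule.span R {m}) bot_le ⟨fun {r s} hrs => hinj ?_⟩).2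
  have := hrs (Submodule.Quotient.mk ⟨m, Submodule.mem_span_singleton_self m⟩)
  rwa [← Submodule.Quotient.mk_smul, ← Submodule.Quotient.mk_smul, Submodule.Quotient.eq,
    Submodule.submoduleOf, Submodule.mem_comap, Submodule.mem_bot, map_sub, sub_eq_zero] at this

theorem isMinimallyFaithful_of_finrank_eq {F : Type*} [Field F] {R : Type u} [CommRing R]
    [IsSemisimpleRing R] [Algebra F R] [FiniteDimensional F R] {M : Type v} [AddCommGroup M]
    [Module F M] [Module R M] [IsScalarTower F R M] [FiniteDimensional F M] [FaithfulSMul R M]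
    (hd : Module.finrank F R = Module.finrank F M) : IsMinimallyFaithful R M := by
  refine ⟨inferInstance, fun P Q _ _ => ?_⟩
  obtain ⟨m, hm⟩ := exists_torsionOf_eq_bot R (Q ⧸ P.submoduleOf Q)
  obtain ⟨q, rfl⟩ := Submodule.Quotient.mk_surjective _ m
  have hq (r : R) (hr : r • (q : M) ∈ P) : r = 0 := by
    rw [← Submodule.mem_bot R, ← hm, Ideal.mem_torsionOf_iff, ← Submodule.Quotient.mk_smul]
    exact (Submodule.Quotient.mk_eq_zero _).2 hr
  have hinj : Function.Injective (LinearMap.toSpanSingleton R M (q : M)) :=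
    (injective_iff_map_eq_zero _).2 fun r hr => hq r (by
      rw [LinearMap.toSpanSingleton_apply] at hr
      exact hr ▸ P.zero_mem)
  have hsurj : Function.Surjective (LinearMap.toSpanSingleton R M (q : M)) :=
    (LinearMap.injective_iff_surjective_of_finrank_eq_finrank
      (f := (LinearMap.toSpanSingleton R M (q : M)).restrictScalars F) hd).1 hinj
  constructor
  · rw [eq_bot_iff]
    intro x hx
    obtain ⟨r, rfl⟩ := hsurj x
    rw [LinearMap.toSpanSingleton_apply] at hx ⊢
    rw [hq r hx, zero_smul, Submodule.mem_bot]
  · rw [eq_top_iff]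
    intro x _
    obtain ⟨r, rfl⟩ := hsurj x
    exact Q.smul_mem r q.2

end MinimallyFaithful

section Splitting

theorem exists_field_isFiniteSplit_tensorProduct (F : Type u) [Field F] (K : Type v) [CommRing K]
    [Algebra F K] [Algebra.Etale F K] :
    ∃ (E : Type u) (_ : Field E) (_ : Algebra F E), FiniteDimensional F E ∧
      Algebra.IsSeparable F E ∧ Algebra.IsFiniteSplit E (E ⊗[F] K) := by
  have : FiniteDimensional F K := Algebra.FormallyUnramified.finite_of_free F K
  have : Small.{u} K := Module.Finite.small.{u} F K
  have : Algebra.Etale F (Shrink.{u} K) := .of_equiv (Shrink.algEquiv F K).symm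
  have : FiniteDimensional F (Shrink.{u} K) := .equiv (Shrink.algEquiv F K).symm.toLinearEquiv
  obtain ⟨T, _, _, _, _, _, hT⟩ := Algebra.IsFiniteSplit.exists_tensorProduct_of_etale
    (R := F) (S := Shrink.{u} K) Module.rankAtStalk_eq_finrank_of_free
  have : Nontrivial T := (TensorProduct.rid F T).toEquiv.symm.nontrivial
  obtain ⟨m, hm⟩ := Ideal.exists_maximal T
  let : Field (T ⧸ m) := Ideal.Quotient.field m
  have hsurj := Ideal.Quotient.mkₐ_surjective F m
  have : Algebra.FormallyUnramified F (T ⧸ m) := .of_surjective (Ideal.Quotient.mkₐ F m) hsurj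
  have : FiniteDimensional F (T ⧸ m) := .of_surjective (Ideal.Quotient.mkₐ F m).toLinearMap hsurj
  exact ⟨T ⧸ m, inferInstance, inferInstance, inferInstance,
    Algebra.FormallyUnramified.isSeparable F (T ⧸ m),
    .of_algEquiv <|
      (Algebra.TensorProduct.cancelBaseChange F T (T ⧸ m) (T ⧸ m) (Shrink.{u} K)).trans
        (Algebra.TensorProduct.congr .refl (Shrink.algEquiv F K))⟩

end Splitting

section MaximalEtale

/-- Infinitesimal lifts of a root of a separable polynomial are unique. -/
theorem formallyUnramified_of_adjoin_isSeparable_eq_top {R S : Type*} [CommRing R] [CommRing S]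
    [Algebra R S] {s : Set S} (htop : Algebra.adjoin R s = ⊤) (hs : ∀ y ∈ s, IsSeparable R y) :
    Algebra.FormallyUnramified R S := by
  rw [Algebra.FormallyUnramified.iff_comp_injective]
  intro B _ _ I hI g₁ g₂ hg
  refine AlgHom.ext_of_adjoin_eq_top htop fun y hy => ?_
  have hroot (g : S →ₐ[R] B) : Polynomial.aeval (g y) (minpoly R y) = 0 := by
    rw [Polynomial.aeval_algHom_apply, minpoly.aeval, map_zero]
  have hnil : IsNilpotent (g₁ y - g₂ y) := by
    have hmem : g₁ y - g₂ y ∈ I := Ideal.Quotient.eq.1 (DFunLike.congr_fun hg y)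
    exact ⟨2, by simpa [hI] using Ideal.pow_mem_pow hmem 2⟩
  have hunit : IsUnit (Polynomial.aeval (g₁ y) (minpoly R y).derivative) := by
    obtain ⟨p, q, hpq⟩ := hs y hy
    refine .of_mul_eq_one_right (Polynomial.aeval (g₁ y) q) ?_
    simpa [hroot g₁] using congrArg (Polynomial.aeval (g₁ y)) hpq
  exact (Polynomial.existsUnique_nilpotent_sub_and_aeval_eq_zero
    (x := g₁ y) ((hroot g₁).symm ▸ .zero) hunit).unique
    ⟨by simp, hroot g₁⟩ ⟨hnil, hroot g₂⟩

open scoped IsMulCommutative in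
theorem exists_etale_forall_isSeparable_mem (F : Type u) [Field F] (N : Type v) [Ring N]
    [Algebra F N] [FiniteDimensional F N] :
    ∃ (K : Subalgebra F N) (_ : IsMulCommutative K), Algebra.Etale F K ∧
      ∀ y, (∀ k ∈ K, k * y = y * k) → IsSeparable F y → y ∈ K := by
  obtain ⟨s, ⟨hs, hmax⟩⟩ := zorn_subset
    {s : Set N | (∀ x ∈ s, IsSeparable F x) ∧ s.Pairwise Commute} fun c hc hchain =>
      ⟨⋃₀ c, ⟨fun x ⟨t, ht, hx⟩ => (hc ht).1 x hx,
        (Set.pairwise_sUnion hchain.directedOn).2 fun t ht => (hc ht).2⟩,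
        fun _ => Set.subset_sUnion_of_mem⟩
  have hK : IsMulCommutative (Algebra.adjoin F s) := Algebra.isMulCommutative_adjoin F
    fun x hx y hy => (hs.2.of_refl hx hy)
  have : Algebra.FormallyUnramified F (Algebra.adjoin F s) :=
    formallyUnramified_of_adjoin_isSeparable_eq_top Algebra.adjoin_adjoin_coe_preimage
      fun y hy => by
        have := hs.1 y hy
        rwa [IsSeparable, ← minpoly.algHom_eq (Algebra.adjoin F s).val Subtype.val_injective]
  refine ⟨_, hK, ⟨.of_formallyUnramified_of_field F _, .of_finiteType.1 inferInstance⟩,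
    fun y hcomm hsep => Algebra.subset_adjoin ?_⟩
  have hinsert : (∀ x ∈ insert y s, IsSeparable F x) ∧ (insert y s).Pairwise Commute :=
    ⟨Set.forall_mem_insert.2 ⟨hsep, hs.1⟩, Set.pairwise_insert_of_symm.2
      ⟨hs.2, fun x hx _ => (hcomm x (Algebra.subset_adjoin hx)).symm⟩⟩
  exact hmax hinsert (Set.subset_insert y s) (Set.mem_insert y s)

end MaximalEtale

section Slices

variable {F T V : Type*} [Field F] [AddCommGroup V] [Module F V]

section Module

variable [AddCommGroup T] [Module F T]

/-- Contraction of the left factor of a tensor product with a linear functional. The coefficients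
of a tensor in a basis of the left factor are slices of it. -/
noncomputable def slice (φ : T →ₗ[F] F) : T ⊗[F] V →ₗ[F] V :=
  (TensorProduct.lid F V).toLinearMap ∘ₗ LinearMap.rTensor V φ

theorem slice_tmul (φ : T →ₗ[F] F) (t : T) (v : V) : slice φ (t ⊗ₜ v) = φ t • v :=
  TensorProduct.lid_tmul _ _

theorem slice_lTensor {W : Type*} [AddCommGroup W] [Module F W] (φ : T →ₗ[F] F) (f : V →ₗ[F] W)
    (x : T ⊗[F] V) : slice φ (LinearMap.lTensor T f x) = f (slice φ x) := by
  refine LinearMap.congr_fun (f := slice φ ∘ₗ LinearMap.lTensor T f) (g := f ∘ₗ slice φ) ?_ x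
  ext
  simp [slice_tmul]

theorem eq_zero_of_forall_slice_eq_zero {x : T ⊗[F] V} (hx : ∀ φ : T →ₗ[F] F, slice φ x = 0) :
    x = 0 :=
  (TensorProduct.equivFinsuppOfBasisLeft (Module.Free.chooseBasis F T)).map_eq_zero_iff.1 <|
    Finsupp.ext fun _ => (TensorProduct.equivFinsuppOfBasisLeft_apply _ _ _).trans (hx _)

theorem mem_range_lTensor_subtype {U : Submodule F V} {x : T ⊗[F] V}
    (hx : ∀ φ : T →ₗ[F] F, slice φ x ∈ U) :
    x ∈ LinearMap.range (LinearMap.lTensor T U.subtype) := by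
  have hexact : Function.Exact U.subtype U.mkQ := LinearMap.exact_subtype_mkQ U
  refine (lTensor_exact T hexact U.mkQ_surjective x).1 (eq_zero_of_forall_slice_eq_zero fun φ => ?_)
  rw [slice_lTensor, Submodule.mkQ_apply, Submodule.Quotient.mk_eq_zero]
  exact hx φ

end Module

variable [CommRing T] [Algebra F T] {A : Type*} [NonAssocRing A] [Module F A]
  [SMulCommClass F A A] [IsScalarTower F A A]

theorem slice_mul_one_tmul (φ : T →ₗ[F] F) (x : T ⊗[F] A) (a : A) :
    slice φ (x * (1 ⊗ₜ a)) = slice φ x * a := by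
  induction x with
  | zero => simp only [zero_mul, map_zero]
  | add x y hx hy => rw [add_mul, map_add, map_add, hx, hy, add_mul]
  | tmul t v =>
    rw [Algebra.TensorProduct.tmul_mul_tmul, slice_tmul, slice_tmul, mul_one, smul_mul_assoc]

theorem slice_one_tmul_mul (φ : T →ₗ[F] F) (x : T ⊗[F] A) (a : A) :
    slice φ ((1 ⊗ₜ a) * x) = a * slice φ x := by
  induction x with
  | zero => simp only [mul_zero, map_zero]
  | add x y hx hy => rw [mul_add, map_add, map_add, hx, hy, mul_add]
  | tmul t v =>
    rw [Algebra.TensorProduct.tmul_mul_tmul, slice_tmul, slice_tmul, one_mul, mul_smul_comm]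

end Slices

section NucleusBaseChange

variable {F : Type u} [Field F] {A : Type v} [NonAssocRing A] [Module F A]
  [SMulCommClass F A A] [IsScalarTower F A A] {Ω : Type w} [Field Ω] [Algebra F Ω]

theorem slice_mem_nucleus {x : Ω ⊗[F] A} (hx : x ∈ nucleus Ω (Ω ⊗[F] A)) (φ : Ω →ₗ[F] F) :
    slice φ x ∈ nucleus F A := by
  have hmul (a b : A) : (1 : Ω) ⊗ₜ[F] (a * b) = (1 ⊗ₜ a) * (1 ⊗ₜ b) := by
    rw [Algebra.TensorProduct.tmul_mul_tmul, mul_one]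
  obtain ⟨hleft, hmid, hright⟩ := mem_nucleus_iff.1 hx
  refine mem_nucleus_iff.2 ⟨fun a b => ?_, fun a b => ?_, fun a b => ?_⟩
  · rw [← slice_mul_one_tmul, ← slice_mul_one_tmul, ← slice_mul_one_tmul, hleft, hmul]
  · simp only [← slice_one_tmul_mul, ← slice_mul_one_tmul, hmid]
  · rw [← slice_one_tmul_mul, ← slice_one_tmul_mul, ← slice_one_tmul_mul, ← hright, hmul]

theorem one_tmul_mem_nucleus (x : nucleus F A) :
    (1 : Ω) ⊗ₜ[F] (x : A) ∈ nucleus Ω (Ω ⊗[F] A) := by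
  rw [mem_nucleus_iff]
  refine ⟨fun a b => ?_, fun a b => ?_, fun a b => ?_⟩
  all_goals
    induction a with
    | zero => simp only [mul_zero, zero_mul]
    | add a a' ha ha' => simp only [mul_add, add_mul, ha, ha']
    | tmul ω a =>
      induction b with
      | zero => simp only [mul_zero, zero_mul]
      | add b b' hb hb' => simp only [mul_add, hb, hb', add_mul]
      | tmul ω' b =>
        simp only [Algebra.TensorProduct.tmul_mul_tmul, one_mul, mul_one, nucleus_left,
          nucleus_mid, nucleus_right]

theorem baseChange_subtype_mem_nucleus (x : Ω ⊗[F] nucleus F A) :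
    (nucleus F A).subtype.baseChange Ω x ∈ nucleus Ω (Ω ⊗[F] A) := by
  induction x with
  | zero => simp only [map_zero, zero_mem]
  | add x y hx hy => simpa only [map_add] using add_mem hx hy
  | tmul ω x =>
    rw [LinearMap.baseChange_tmul, TensorProduct.tmul_eq_smul_one_tmul]
    exact Submodule.smul_mem _ ω (one_tmul_mem_nucleus x)

theorem baseChange_subtype_mul (x y : Ω ⊗[F] nucleus F A) :
    (nucleus F A).subtype.baseChange Ω (x * y) =
      (nucleus F A).subtype.baseChange Ω x * (nucleus F A).subtype.baseChange Ω y := by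
  induction x with
  | zero => simp only [zero_mul, map_zero]
  | add x x' hx hx' => simp only [add_mul, map_add, hx, hx']
  | tmul ω x =>
    induction y with
    | zero => simp only [mul_zero, map_zero]
    | add y y' hy hy' => simp only [mul_add, map_add, hy, hy']
    | tmul ω' y =>
      simp only [Algebra.TensorProduct.tmul_mul_tmul, LinearMap.baseChange_tmul,
        Submodule.subtype_apply, nucleus_coe_mul]

variable (F A Ω) in
/-- The nucleus commutes with extension of scalars. -/
noncomputable def nucleusBaseChange : Ω ⊗[F] nucleus F A ≃ₐ[Ω] nucleus Ω (Ω ⊗[F] A) :=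
  .ofBijective
    (.ofLinearMap
      (((nucleus F A).subtype.baseChange Ω).codRestrict _ baseChange_subtype_mem_nucleus) rfl
      fun x y => Subtype.ext (baseChange_subtype_mul x y))
    ⟨fun _ _ h => Module.Flat.lTensor_preserves_injective_linearMap (M := Ω) _
      (nucleus F A).injective_subtype (congrArg Subtype.val h),
    fun x => (mem_range_lTensor_subtype fun φ => slice_mem_nucleus x.2 φ).imp
      fun _ => Subtype.ext⟩

theorem coe_nucleusBaseChange_tmul (ω : Ω) (x : nucleus F A) :
    (nucleusBaseChange F A Ω (ω ⊗ₜ x) : Ω ⊗[F] A) = ω ⊗ₜ (x : A) := rfl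

end NucleusBaseChange

section SplitIdempotents

variable {Ω T ι : Type*} [Field Ω] [CommRing T] [Algebra Ω T] [DecidableEq ι]
  (e : T ≃ₐ[Ω] (ι → Ω))

/-- The primitive idempotents of a split algebra, indexed by the factors of a splitting. -/
def splitIdempotent (i : ι) : T := e.symm (Pi.single i 1)

theorem mul_splitIdempotent (t : T) (i : ι) :
    t * splitIdempotent e i = e t i • splitIdempotent e i := by
  apply e.injective
  rw [map_mul, map_smul, splitIdempotent, e.apply_symm_apply, ← Pi.single_smul, smul_eq_mul,
    mul_one, ← Pi.single_mul_right, mul_one]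

theorem completeOrthogonalIdempotents_splitIdempotent [Fintype ι] :
    CompleteOrthogonalIdempotents (splitIdempotent e) :=
  (CompleteOrthogonalIdempotents.single fun _ : ι => Ω).map e.symm.toRingEquiv.toRingHom

theorem isIdempotentElem_splitIdempotent (i : ι) : IsIdempotentElem (splitIdempotent e i) := by
  have hsingle : IsIdempotentElem (Pi.single i 1 : ι → Ω) := by
    rw [IsIdempotentElem, ← Pi.single_mul, mul_one]
  exact hsingle.map e.symm

theorem splitIdempotent_ne_zero (i : ι) : splitIdempotent e i ≠ 0 :=
  e.symm.map_ne_zero_iff.2 (Pi.single_ne_zero_iff.2 one_ne_zero)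

end SplitIdempotents

section PairCharacters

variable {F : Type*} [Field F] {Ω K ι : Type*} [Field Ω] [Algebra F Ω] [CommRing K] [Algebra F K]
  (e : Ω ⊗[F] K ≃ₐ[Ω] (ι → Ω))

/-- The characters of an algebra attached to the factors of a splitting of it. -/
def splitCharacter (i : ι) : K →ₐ[F] Ω :=
  (((Pi.evalAlgHom Ω (fun _ => Ω) i).comp e.toAlgHom).restrictScalars F).comp
    Algebra.TensorProduct.includeRight

/-- The character `k ⊗ k' ↦ χ i k * χ j k'` of `K ⊗ K`, where `χ` runs over the characters of `K`
attached to a splitting. -/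
noncomputable def pairCharacter (i j : ι) : K ⊗[F] K →ₐ[F] Ω :=
  Algebra.TensorProduct.lift (splitCharacter e i) (splitCharacter e j) fun _ _ => Commute.all _ _

theorem pairCharacter_tmul (i j : ι) (k k' : K) :
    pairCharacter e i j (k ⊗ₜ k') = e (1 ⊗ₜ k) i * e (1 ⊗ₜ k') j :=
  Algebra.TensorProduct.lift_tmul _ _ _ _ _

theorem eq_zero_of_forall_splitCharacter_eq_zero {k : K} (hk : ∀ i, splitCharacter e i k = 0) :
    k = 0 :=
  Module.FaithfullyFlat.tensorProduct_mk_injective (A := F) (B := Ω) K <| e.injective <| by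
    rw [map_zero, map_zero]
    exact funext hk

theorem eq_zero_of_forall_pairCharacter_eq_zero {t : K ⊗[F] K}
    (ht : ∀ i j, pairCharacter e i j t = 0) : t = 0 := by
  have hright (j : ι) : LinearMap.lTensor K (splitCharacter e j).toLinearMap t = 0 := by
    refine (TensorProduct.comm F K Ω).injective (e.injective (funext fun i => ?_))
    suffices h : LinearMap.proj i ∘ₗ e.toLinearMap.restrictScalars F ∘ₗ
        (TensorProduct.comm F K Ω).toLinearMap ∘ₗ
          LinearMap.lTensor K (splitCharacter e j).toLinearMap =
        (pairCharacter e i j).toLinearMap by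
      simpa using (LinearMap.congr_fun h t).trans (ht i j)
    ext k k'
    have hk : splitCharacter e j k' ⊗ₜ[F] k = splitCharacter e j k' • ((1 : Ω) ⊗ₜ[F] k) :=
      TensorProduct.tmul_eq_smul_one_tmul _ _
    suffices h : splitCharacter e j k' * e (1 ⊗ₜ k) i = e (1 ⊗ₜ k) i * e (1 ⊗ₜ k') j by
      simpa [hk, pairCharacter_tmul] using h
    exact mul_comm _ _
  refine eq_zero_of_forall_slice_eq_zero fun φ =>
    eq_zero_of_forall_splitCharacter_eq_zero e fun j => ?_
  have := slice_lTensor φ (splitCharacter e j).toLinearMap t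
  rw [hright, map_zero] at this
  exact this.symm

include e in
theorem finrank_eq_card_of_algEquiv [Fintype ι] : Module.finrank F K = Fintype.card ι := by
  rw [← Module.finrank_baseChange (R := Ω), e.toLinearEquiv.finrank_eq,
    Module.finrank_fintype_fun_eq_card]

end PairCharacters

section NuclearIdempotents

open scoped IsMulCommutative

variable {F : Type u} [Field F] {A : Type v} [NonAssocRing A] [Module F A]
  [SMulCommClass F A A] [IsScalarTower F A A] {Ω : Type w} [Field Ω] [Algebra F Ω]

/-- The embedding of `Ω ⊗ K` into the nucleus of `Ω ⊗ A`, for a subalgebra `K` of the nucleus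
of `A`. -/
noncomputable def nuclearEmbedding (Ω : Type w) [Field Ω] [Algebra F Ω]
    (K : Subalgebra F (nucleus F A)) : Ω ⊗[F] K →ₐ[Ω] nucleus Ω (Ω ⊗[F] A) :=
  (nucleusBaseChange F A Ω).toAlgHom.comp (Algebra.TensorProduct.map (.id Ω Ω) K.val)

variable {K : Subalgebra F (nucleus F A)}

theorem coe_nuclearEmbedding_one_tmul (k : K) :
    (nuclearEmbedding Ω K (1 ⊗ₜ k) : Ω ⊗[F] A) = 1 ⊗ₜ ((k : nucleus F A) : A) := rfl

variable [IsMulCommutative K] {ι : Type*} [DecidableEq ι] (e : Ω ⊗[F] K ≃ₐ[Ω] (ι → Ω))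

/-- The primitive idempotents of `Ω ⊗ K`, as idempotents of the nucleus of `Ω ⊗ A`. -/
noncomputable def nuclearIdempotent (i : ι) : nucleus Ω (Ω ⊗[F] A) :=
  nuclearEmbedding Ω K (splitIdempotent e i)

theorem nuclearEmbedding_mul_nuclearIdempotent (t : Ω ⊗[F] K) (i : ι) :
    nuclearEmbedding Ω K t * nuclearIdempotent e i = e t i • nuclearIdempotent e i := by
  rw [nuclearIdempotent, ← map_mul, mul_splitIdempotent, map_smul]

theorem nuclearIdempotent_mul_nuclearEmbedding (t : Ω ⊗[F] K) (i : ι) :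
    nuclearIdempotent e i * nuclearEmbedding Ω K t = e t i • nuclearIdempotent e i := by
  rw [nuclearIdempotent, ← map_mul, mul_comm, mul_splitIdempotent, map_smul]

theorem completeOrthogonalIdempotents_nuclearIdempotent [Fintype ι] :
    CompleteOrthogonalIdempotents (nuclearIdempotent e) :=
  (completeOrthogonalIdempotents_splitIdempotent e).map (nuclearEmbedding Ω K).toRingHom

theorem peirce_one_tmul_biAction (i j : ι) (t : K ⊗[F] K) (a : A) :
    (nuclearIdempotent e i : Ω ⊗[F] A) * (1 ⊗ₜ biAction K t a) *
        (nuclearIdempotent e j : Ω ⊗[F] A) =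
      pairCharacter e i j t • ((nuclearIdempotent e i : Ω ⊗[F] A) *
        (1 ⊗ₜ a) * (nuclearIdempotent e j : Ω ⊗[F] A)) := by
  induction t with
  | zero =>
    simp only [map_zero, LinearMap.zero_apply, TensorProduct.tmul_zero, mul_zero, zero_mul,
      zero_smul]
  | add s t hs ht =>
    rw [map_add, LinearMap.add_apply, TensorProduct.tmul_add, mul_add, add_mul, hs, ht, map_add,
      add_smul]
  | tmul k k' =>
    have hact : (1 : Ω) ⊗ₜ[F] biAction K (k ⊗ₜ k') a =
        (nuclearEmbedding Ω K (1 ⊗ₜ k) : Ω ⊗[F] A) * (1 ⊗ₜ a) *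
          (nuclearEmbedding Ω K (1 ⊗ₜ k') : Ω ⊗[F] A) := by
      simp only [biAction_tmul, coe_nuclearEmbedding_one_tmul,
        Algebra.TensorProduct.tmul_mul_tmul, one_mul]
    rw [hact, ← nucleus_left, nucleus_mul_mul, mul_nucleus_mul,
      nuclearIdempotent_mul_nuclearEmbedding, nuclearEmbedding_mul_nuclearIdempotent]
    simp only [Submodule.coe_smul, smul_mul_assoc, mul_smul_comm, smul_smul, pairCharacter_tmul,
      mul_comm]

theorem isFrame_of_biAction_bijective [Fintype ι] {a : A}
    (ha : Function.Bijective fun t => biAction K t a) :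
    IsFrame (nuclearIdempotent e) fun i j =>
      (nuclearIdempotent e i : Ω ⊗[F] A) * (1 ⊗ₜ a) *
        (nuclearIdempotent e j : Ω ⊗[F] A) := by
  refine .of_finrank_eq (completeOrthogonalIdempotents_nuclearIdempotent e) _ (fun i j y => ?_) ?_
  · induction y with
    | zero => exact ⟨0, by simp only [mul_zero, zero_mul, zero_smul]⟩
    | add x y hx hy =>
      obtain ⟨r, hr⟩ := hx
      obtain ⟨s, hs⟩ := hy
      exact ⟨r + s, by rw [mul_add, add_mul, hr, hs, add_smul]⟩
    | tmul ω y =>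
      obtain ⟨t, rfl⟩ := ha.2 y
      refine ⟨ω * pairCharacter e i j t, ?_⟩
      rw [mul_smul, ← peirce_one_tmul_biAction, TensorProduct.tmul_eq_smul_one_tmul, mul_smul_comm,
        smul_mul_assoc]
  · rw [Module.finrank_baseChange, ← (LinearEquiv.ofBijective
      (LinearMap.applyₗ a ∘ₗ (biAction K).toLinearMap) ha).finrank_eq, Module.finrank_tensorProduct,
      finrank_eq_card_of_algEquiv e]

theorem biAction_injective_of_isFrame [Fintype ι] {u : ι → ι → Ω ⊗[F] A}
    (h : IsFrame (nuclearIdempotent e) u) :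
    Function.Injective (biAction K) := by
  refine (injective_iff_map_eq_zero _).2 fun t ht =>
    eq_zero_of_forall_pairCharacter_eq_zero e fun i j => ?_
  have hzero (y : Ω ⊗[F] A) : pairCharacter e i j t •
      ((nuclearIdempotent e i : Ω ⊗[F] A) * y *
        (nuclearIdempotent e j : Ω ⊗[F] A)) = 0 := by
    induction y with
    | zero => simp only [mul_zero, zero_mul, smul_zero]
    | add x y hx hy => rw [mul_add, add_mul, smul_add, hx, hy, add_zero]
    | tmul ω a =>
      rw [TensorProduct.tmul_eq_smul_one_tmul, mul_smul_comm, smul_mul_assoc, smul_comm,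
        ← peirce_one_tmul_biAction, ht, LinearMap.zero_apply, TensorProduct.tmul_zero,
        mul_zero, zero_mul, smul_zero]
  have hu := hzero (u i j)
  rw [h.left_mul, h.mul_right] at hu
  exact (smul_eq_zero.1 hu).resolve_right (h.ne_zero i j)

end NuclearIdempotents

section SeparablePowers

open Polynomial

variable {F C : Type*} [Field F] [Ring C] [Algebra F C]

theorem isSeparable_of_isIdempotentElem {e : C} (he : IsIdempotentElem e) : IsSeparable F e := by
  have hsep : (X * (X - Polynomial.C 1) : F[X]).Separable :=
    separable_X.mul separable_X_sub_C ⟨1, -1, by simp⟩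
  refine hsep.of_dvd (minpoly.dvd F e ?_)
  rw [map_mul, map_sub, aeval_X, map_one, map_one, mul_sub, mul_one, he.eq, sub_self]

theorem isSeparable_of_mem_adjoin_pow_char (p : ℕ) [CharP F p] {z : C}
    (hz : z ∈ Algebra.adjoin F {z ^ p}) : IsSeparable F z := by
  obtain ⟨f, hf⟩ := Algebra.adjoin_mem_exists_aeval F (z ^ p) hz
  have hsep : (X - expand F p f).Separable := by
    rw [separable_def, map_sub, derivative_X, derivative_expand, CharP.cast_eq_zero, zero_mul,
      mul_zero, sub_zero]
    exact isCoprime_one_right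
  refine hsep.of_dvd (minpoly.dvd F z ?_)
  rw [map_sub, aeval_X, expand_aeval, hf, sub_self]

variable [FiniteDimensional F C]

/-- The subalgebras generated by the iterated `p`-th powers of `y` form a stationary chain. -/
theorem exists_isSeparable_pow_char_pow (p : ℕ) [CharP F p] (y : C) :
    ∃ m, IsSeparable F (y ^ p ^ m) := by
  let chain : ℕ →o (Submodule F C)ᵒᵈ :=
    { toFun m := OrderDual.toDual (Algebra.adjoin F {y ^ p ^ m}).toSubmodule
      monotone' := monotone_nat_of_le_succ fun m => by
        refine Algebra.adjoin_le (Set.singleton_subset_iff.2 ?_)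
        rw [pow_succ, pow_mul]
        exact pow_mem (Algebra.self_mem_adjoin_singleton F _) p }
  obtain ⟨m, hm⟩ := IsArtinian.monotone_stabilizes chain
  have hmem : y ^ p ^ m ∈ Algebra.adjoin F {y ^ p ^ (m + 1)} :=
    (hm (m + 1) m.le_succ).ge (Algebra.self_mem_adjoin_singleton F _)
  rw [pow_succ, pow_mul] at hmem
  exact ⟨m, isSeparable_of_mem_adjoin_pow_char p hmem⟩

theorem exists_isSeparable_isNilpotent_sub [PerfectField F] (y : C) :
    ∃ s, IsSeparable F s ∧ IsNilpotent (y - s) := by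
  have hmul : Function.Injective (Algebra.lmul F C) := Algebra.lmul_injective
  obtain ⟨n, -, s, hs, hn, hss, hns⟩ :=
    (Algebra.lmul F C y).exists_isNilpotent_isSemisimple
  rw [← AlgHom.map_adjoin_singleton] at hs
  obtain ⟨s, -, rfl⟩ := hs
  refine ⟨s, ?_, ?_⟩
  · rw [IsSeparable, ← minpoly.algHom_eq _ hmul, PerfectField.separable_iff_squarefree]
    exact hss.minpoly_squarefree
  · rw [← IsNilpotent.map_iff hmul, map_sub, hns]
    simpa using hn

theorem exists_isSeparable_isNilpotent_pow_sub (q : ℕ) [hq : ExpChar F q] (y : C) :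
    ∃ m s, IsSeparable F s ∧ IsNilpotent (y ^ q ^ m - s) := by
  cases hq with
  | zero =>
    obtain ⟨s, hs, hn⟩ := exists_isSeparable_isNilpotent_sub (F := F) y
    exact ⟨0, s, hs, by rwa [pow_zero, pow_one]⟩
  | prime =>
    obtain ⟨m, hm⟩ := exists_isSeparable_pow_char_pow (F := F) q y
    exact ⟨m, _, hm, by rw [sub_self]; exact .zero⟩

end SeparablePowers

section Radical

theorem mul_comm_of_forall_pow_expChar_pow_mem_center {D : Type*} [DivisionRing D] (q : ℕ)
    [hq : ExpChar D q] (h : ∀ x : D, ∃ m : ℕ, x ^ q ^ m ∈ Subring.center D) (x y : D) :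
    x * y = y * x := by
  have : ExpChar (Subring.center D) q := ExpChar.expChar_center_iff.2 hq
  have : IsPurelyInseparable (Subring.center D) D :=
    (isPurelyInseparable_iff_pow_mem _ q).2 fun x => (h x).imp fun m hm => ⟨⟨_, hm⟩, rfl⟩
  have : Algebra.IsAlgebraic (Subring.center D) D := this.isAlgebraic
  have htop : Subring.center D = ⊤ := by
    by_contra hne
    obtain ⟨z, hz, hs⟩ := JacobsonNoether.exists_separable_and_not_isCentral D hne
    obtain ⟨c, rfl⟩ := IsPurelyInseparable.inseparable (Subring.center D) z hs
    exact hz c.2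
  exact (Subring.mem_center_iff.1 (htop ▸ Subring.mem_top x : x ∈ Subring.center D) y).symm

theorem isUnit_quotient_of_isMaximal {R : Type*} [Ring R] {I : Ideal R} [I.IsTwoSided]
    (hI : I.IsMaximal) {a : R ⧸ I} (ha : a ≠ 0) : IsUnit a := by
  let id' : (R ⧸ I) →ₛₗ[Ideal.Quotient.mk I] (R ⧸ I) :=
    { AddMonoidHom.id (R ⧸ I) with map_smul' _ _ := rfl }
  have hsimple : IsSimpleModule R (R ⧸ I) := isSimpleModule_iff_isCoatom.2 hI.out
  have : IsSimpleModule (R ⧸ I) (R ⧸ I) :=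
    (id'.isSimpleModule_iff_of_bijective Function.bijective_id).1 hsimple
  exact (isSimpleModule_self_iff_isUnit.1 this).2 a ha

variable {R : Type*} [Ring R] [IsSemisimpleRing R]

theorem isTwoSided_of_forall_isIdempotentElem_mem_center
    (h : ∀ e : R, IsIdempotentElem e → e ∈ Subring.center R) (I : Ideal R) : I.IsTwoSided := by
  obtain ⟨e, he, rfl⟩ := IsSemisimpleRing.ideal_eq_span_idempotent I
  refine ⟨fun {x} y hx => ?_⟩
  obtain ⟨r, rfl⟩ := Ideal.mem_span_singleton'.1 hx
  rw [mul_assoc, ← Subring.mem_center_iff.1 (h e he), ← mul_assoc]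
  exact Ideal.mem_span_singleton'.2 ⟨_, rfl⟩

theorem isReduced_of_forall_isIdempotentElem_mem_center
    (h : ∀ e : R, IsIdempotentElem e → e ∈ Subring.center R) : IsReduced R := by
  refine (isReduced_iff_pow_one_lt 2 one_lt_two).2 fun x hx => ?_
  obtain ⟨e, he, hspan⟩ := IsSemisimpleRing.ideal_eq_span_idempotent (Ideal.span {x})
  obtain ⟨r, hr⟩ := Ideal.mem_span_singleton'.1 (hspan.ge (Ideal.mem_span_singleton_self e))
  obtain ⟨s, hs⟩ := Ideal.mem_span_singleton'.1 (hspan.le (Ideal.mem_span_singleton_self x))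
  calc x = x * e := by rw [← hs, mul_assoc, he.eq]
    _ = e * x := Subring.mem_center_iff.1 (h e he) x
    _ = 0 := by rw [← hr, mul_assoc, ← pow_two, hx, mul_zero]

/-- The quotients by maximal left ideals are division rings, to which the Jacobson–Noether theorem
applies. -/
theorem mul_comm_of_isSemisimpleRing {F : Type*} [Field F] (q : ℕ) [ExpChar F q] [Algebra F R]
    (h : ∀ x : R, ∃ m : ℕ, x ^ q ^ m ∈ Subring.center R) (x y : R) : x * y = y * x := by
  have hidem (e : R) (he : IsIdempotentElem e) : e ∈ Subring.center R := by
    obtain ⟨m, hm⟩ := h e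
    rwa [he.pow_eq (pow_pos (expChar_pos F q) m).ne'] at hm
  rw [← sub_eq_zero, ← Ideal.mem_bot, ← IsSemisimpleRing.jacobson_eq_bot,
    Ring.jacobson_eq_sInf_isMaximal, Ideal.mem_sInf]
  intro I hI
  have := isTwoSided_of_forall_isIdempotentElem_mem_center hidem I
  have hmk : Function.Surjective (Ideal.Quotient.mk I) := Ideal.Quotient.mk_surjective
  have : Nontrivial (R ⧸ I) := Ideal.Quotient.nontrivial_iff.2 hI.ne_top
  let _ : DivisionRing (R ⧸ I) := .ofIsUnitOrEqZero fun a =>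
    or_iff_not_imp_right.2 (isUnit_quotient_of_isMaximal hI)
  have : ExpChar (R ⧸ I) q := expChar_of_injective_algebraMap (algebraMap F (R ⧸ I)).injective q
  rw [← Ideal.Quotient.eq, map_mul, map_mul]
  refine mul_comm_of_forall_pow_expChar_pow_mem_center q (hmk.forall.2 fun z => ?_) _ _
  obtain ⟨m, hm⟩ := h z
  refine ⟨m, Subring.mem_center_iff.2 (hmk.forall.2 fun w => ?_)⟩
  rw [← map_pow, ← map_mul, ← map_mul, Subring.mem_center_iff.1 hm]

end Radical

section CommutativeQuotient

variable {F : Type u} [Field F] {C : Type v} [Ring C] [Algebra F C] [FiniteDimensional F C]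

/-- The quotient is `C` modulo its radical. Idempotents lift along it, and the lifts are separable,
hence central. -/
theorem exists_commRing_quotient_of_isSeparable_mem_center (q : ℕ) [ExpChar F q]
    (hsep : ∀ s : C, IsSeparable F s → s ∈ Subring.center C) :
    ∃ (S : Type v) (_ : CommRing S) (_ : Algebra F S) (π : C →ₐ[F] S), Function.Surjective π ∧
      IsNilpotent (LinearMap.ker π.toLinearMap) ∧
      ∀ y, ∃ m s, IsSeparable F s ∧ π y ^ q ^ m = π s := by
  have : IsArtinianRing C := .of_finite F C
  let π : C →ₐ[F] C ⧸ Ring.jacobson C := Ideal.Quotient.mkₐ F _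
  have hπ : Function.Surjective π := Ideal.Quotient.mk_surjective
  have hker : LinearMap.ker π.toLinearMap = (Ring.jacobson C).restrictScalars F :=
    Submodule.ext fun _ => Ideal.Quotient.eq_zero_iff_mem
  have hnilpotent : IsNilpotent (LinearMap.ker π.toLinearMap) := by
    obtain ⟨n, hn⟩ := IsSemiprimaryRing.isNilpotent (R := C)
    refine ⟨n + 1, ?_⟩
    rw [hker, ← Submodule.restrictScalars_pow n.succ_ne_zero, Submodule.pow_succ, hn, zero_mul]
    rfl
  have hnil (z : C) (hz : π z = 0) : IsNilpotent z := by
    refine hnilpotent.imp fun n hn => ?_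
    have := Submodule.pow_mem_pow (LinearMap.ker π.toLinearMap) hz n
    rwa [hn, Submodule.zero_eq_bot, Submodule.mem_bot] at this
  have hcenter {s : C} (hs : IsSeparable F s) : π s ∈ Subring.center (C ⧸ Ring.jacobson C) :=
    Subring.mem_center_iff.2 <| hπ.forall.2 fun y => by
      rw [← map_mul, ← map_mul, Subring.mem_center_iff.1 (hsep s hs)]
  have : IsReduced (C ⧸ Ring.jacobson C) :=
    isReduced_of_forall_isIdempotentElem_mem_center fun e he => by
      obtain ⟨e', he', rfl⟩ := exists_isIdempotentElem_eq_of_ker_isNilpotent π.toRingHom hnil e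
        (hπ e) he
      exact hcenter (isSeparable_of_isIdempotentElem he')
  have hpow (y : C) : ∃ m s, IsSeparable F s ∧ π y ^ q ^ m = π s := by
    obtain ⟨m, s, hs, hn⟩ := exists_isSeparable_isNilpotent_pow_sub (F := F) q y
    exact ⟨m, s, hs, by rw [← sub_eq_zero, ← map_pow, ← map_sub, (hn.map π).eq_zero]⟩
  have hcomm : ∀ x y : C ⧸ Ring.jacobson C, x * y = y * x :=
    mul_comm_of_isSemisimpleRing (F := F) q <| hπ.forall.2 fun y => by
      obtain ⟨m, s, hs, hm⟩ := hpow y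
      exact ⟨m, hm ▸ hcenter hs⟩
  exact ⟨_, { (inferInstance : Ring (C ⧸ Ring.jacobson C)) with mul_comm := hcomm },
    inferInstance, π, hπ, hnilpotent, hpow⟩

end CommutativeQuotient

section BaseChangeQuotient

variable {F : Type*} [Field F] {C S : Type*} [Ring C] [Algebra F C] (Ω : Type*) [Field Ω]
  [Algebra F Ω]

theorem isNilpotent_of_map_eq_zero [Ring S] [Algebra F S] {π : C →ₐ[F] S}
    (hπ : Function.Surjective π) (hker : IsNilpotent (LinearMap.ker π.toLinearMap))
    {x : Ω ⊗[F] C} (hx : Algebra.TensorProduct.map (.id Ω Ω) π x = 0) : IsNilpotent x := by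
  let scalars : Submodule F (Ω ⊗[F] C) := .map Algebra.TensorProduct.includeLeft.toLinearMap ⊤
  let kernel : Submodule F (Ω ⊗[F] C) :=
    .map Algebra.TensorProduct.includeRight.toLinearMap (LinearMap.ker π.toLinearMap)
  have hmem : x ∈ scalars * kernel := by
    have hexact := lTensor_exact Ω π.toLinearMap.exact_subtype_ker_map hπ
    obtain ⟨z, rfl⟩ := (hexact x).1 hx
    clear hx
    induction z with
    | zero => rw [map_zero]; exact zero_mem _
    | add y z hy hz => rw [map_add]; exact add_mem hy hz
    | tmul ω c =>
      have := Submodule.mul_mem_mul (M := scalars) (N := kernel) ⟨ω, trivial, rfl⟩ ⟨c, c.2, rfl⟩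
      simpa using this
  have hcomm : Commute scalars kernel := Submodule.mul_comm_of_commute <| by
    rintro _ ⟨ω, -, rfl⟩ _ ⟨c, -, rfl⟩
    exact (Commute.one_right ω).tmul (Commute.one_left c)
  refine hker.imp fun n hn => ?_
  have hkernel : kernel ^ n = ⊥ := by
    rw [← Submodule.map_pow, hn, Submodule.zero_eq_bot, Submodule.map_bot]
  have hpow := Submodule.pow_mem_pow _ hmem n
  rwa [hcomm.mul_pow, hkernel, Submodule.mul_bot, Submodule.mem_bot] at hpow

theorem exists_pow_expChar_pow_eq_map {K : Type*} [CommRing K] [Algebra F K] [CommRing S]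
    [Algebra F S] (q : ℕ) [ExpChar F q] {κ : K →ₐ[F] S} (hκ : ∀ y, ∃ m k, y ^ q ^ m = κ k)
    (x : Ω ⊗[F] S) : ∃ m t, x ^ q ^ m = Algebra.TensorProduct.map (.id Ω Ω) κ t := by
  cases subsingleton_or_nontrivial (Ω ⊗[F] S)
  · exact ⟨0, 0, Subsingleton.elim _ _⟩
  have : ExpChar (Ω ⊗[F] S) q :=
    expChar_of_injective_algebraMap (algebraMap F (Ω ⊗[F] S)).injective q
  induction x with
  | zero => exact ⟨0, 0, by rw [pow_zero, pow_one, map_zero]⟩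
  | tmul ω y =>
    obtain ⟨m, k, hk⟩ := hκ y
    exact ⟨m, (ω ^ q ^ m) ⊗ₜ k, by
      rw [Algebra.TensorProduct.tmul_pow, hk, Algebra.TensorProduct.map_tmul, AlgHom.id_apply]⟩
  | add x y hx hy =>
    obtain ⟨m, t, ht⟩ := hx
    obtain ⟨m', t', ht'⟩ := hy
    refine ⟨m + m', t ^ q ^ m' + t' ^ q ^ m, ?_⟩
    rw [add_pow_expChar_pow, map_add, map_pow, map_pow, ← ht, ← ht', ← pow_mul, ← pow_mul,
      ← pow_add, ← pow_add, add_comm m' m]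

end BaseChangeQuotient

section LocalIdempotents

variable {Ω M : Type*} [Field Ω] [Ring M] [Algebra Ω M] {ι : Type*} [Fintype ι]

/-- Modulo nilpotents some power of each `x i` is a scalar multiple of `g`, and the scalars cannot
all vanish. -/
theorem exists_mul_eq_of_sum_eq_isIdempotentElem {T : Type*} [CommRing T] [Algebra Ω T]
    {p : M →ₐ[Ω] T} (hp : ∀ x, p x = 0 → IsNilpotent x) {g : M} (hg : IsIdempotentElem g)
    (hg0 : g ≠ 0) {x : ι → M} (hxg : ∀ i, x i * g = x i) (hsum : ∑ i, x i = g)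
    (hpow : ∀ i, ∃ n, 0 < n ∧ ∃ r : Ω, p (x i) ^ n = r • p g) : ∃ i w, w * x i = g := by
  have hg_not_nilpotent : ¬ IsNilpotent g := fun h => hg0 <| by
    obtain ⟨n, hn⟩ := h
    rw [← hg.pow_succ_eq n, pow_succ, hn, zero_mul]
  obtain ⟨i, hi⟩ : ∃ i, ¬ IsNilpotent (p (x i)) := by
    by_contra! hall
    have hpg : IsNilpotent (p g) := by
      rw [← hsum, map_sum]
      exact isNilpotent_sum fun i _ => hall i
    obtain ⟨n, hn⟩ := hpg
    rw [← map_pow] at hn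
    exact hg_not_nilpotent ((hp _ hn).of_pow)
  obtain ⟨n, hn, r, hr⟩ := hpow i
  have hr0 : r ≠ 0 := by
    rintro rfl
    exact hi ⟨n, by rw [hr, zero_smul]⟩
  have hxn : x i ^ n * g = x i ^ n := by
    rw [← Nat.sub_one_add_one hn.ne', pow_succ, mul_assoc, hxg]
  have hz : IsNilpotent (r⁻¹ • x i ^ n - g) := hp _ <| by
    rw [map_sub, map_smul, map_pow, hr, inv_smul_smul₀ hr0, sub_self]
  obtain ⟨w, hw⟩ := hz.isUnit_one_add.exists_left_inv
  refine ⟨i, w * (r⁻¹ • x i ^ (n - 1)), ?_⟩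
  calc w * (r⁻¹ • x i ^ (n - 1)) * x i = w * (r⁻¹ • x i ^ n) := by
        rw [mul_assoc, smul_mul_assoc, ← pow_succ, Nat.sub_one_add_one hn.ne']
    _ = w * ((1 + (r⁻¹ • x i ^ n - g)) * g) := by
        rw [add_mul, sub_mul, smul_mul_assoc, hxn, hg.eq, one_mul, add_sub_cancel]
    _ = g := by rw [← mul_assoc, hw, one_mul]

theorem exists_mul_eq_mul_eq_of_peirce {e f w : M} (he : IsIdempotentElem e)
    (hf : IsIdempotentElem f) (hf0 : f ≠ 0) (hpeirce : ∀ x, ∃ r : Ω, e * x * e = r • e)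
    (hw : w * (f * e * f) = f) : ∃ a b, a * b = f ∧ b * a = e := by
  have hab : f * w * f * e * (e * f) = f := by
    calc f * w * f * e * (e * f) = f * (w * (f * (e * e) * f)) := by noncomm_ring
      _ = f := by rw [he.eq, hw, hf.eq]
  obtain ⟨r, hr⟩ := hpeirce (f * (f * w * f))
  have hba : e * f * (f * w * f * e) = r • e := by rw [← hr]; noncomm_ring
  have hfr : f = r • f := by
    calc f = f * w * f * e * (e * f) * (f * w * f * e * (e * f)) := by rw [hab, hf.eq]
      _ = f * w * f * e * (e * f * (f * w * f * e)) * (e * f) := by noncomm_ring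
      _ = r • (f * w * f * (e * e) * (e * f)) := by
        rw [hba, mul_smul_comm, smul_mul_assoc]; noncomm_ring
      _ = r • f := by rw [he.eq, hab]
  have hr1 : r = 1 := by
    rw [← sub_eq_zero, ← smul_eq_zero_iff_left hf0, sub_smul, ← hfr, one_smul, sub_self]
  exact ⟨_, _, hab, by rw [hba, hr1, one_smul]⟩

end LocalIdempotents

section Centralizer

variable {F : Type*} [Field F] {Ω : Type*} [Field Ω] [Algebra F Ω]

theorem exists_mul_eq_of_isSeparable_mem_range {K C ι : Type*} [CommRing K] [Algebra F K] [Ring C]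
    [Algebra F C] [FiniteDimensional F C] [Fintype ι] {j : K →ₐ[F] C} (hj : Function.Injective j)
    (hcentral : ∀ k, j k ∈ Subring.center C) (hsep : ∀ s, IsSeparable F s → ∃ k, j k = s)
    {f : Ω ⊗[F] K} (hf : IsIdempotentElem f) (hf0 : f ≠ 0) (hline : ∀ t, ∃ r : Ω, t * f = r • f)
    {x : ι → Ω ⊗[F] C} (hxf : ∀ i, x i * Algebra.TensorProduct.map (.id Ω Ω) j f = x i)
    (hsum : ∑ i, x i = Algebra.TensorProduct.map (.id Ω Ω) j f) :
    ∃ i w, w * x i = Algebra.TensorProduct.map (.id Ω Ω) j f := by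
  obtain ⟨q, _⟩ := ExpChar.exists F
  obtain ⟨S, _, _, π, hπ, hker, hpow⟩ := exists_commRing_quotient_of_isSeparable_mem_center q
    fun s hs => (hsep s hs).elim fun k hk => hk ▸ hcentral k
  have hpowK : ∀ y : S, ∃ m k, y ^ q ^ m = (π.comp j) k := hπ.forall.2 fun y => by
    obtain ⟨m, s, hs, hm⟩ := hpow y
    obtain ⟨k, rfl⟩ := hsep s hs
    exact ⟨m, k, hm⟩
  let p := Algebra.TensorProduct.map (.id Ω Ω) π
  have hcomp (t : Ω ⊗[F] K) : Algebra.TensorProduct.map (.id Ω Ω) (π.comp j) t =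
      p (Algebra.TensorProduct.map (.id Ω Ω) j t) :=
    DFunLike.congr_fun (Algebra.TensorProduct.map_id_comp π j) t
  set g := Algebra.TensorProduct.map (.id Ω Ω) j f
  have hg : IsIdempotentElem g := hf.map _
  have hinj : Function.Injective (Algebra.TensorProduct.map (.id Ω Ω) j) :=
    Module.Flat.lTensor_preserves_injective_linearMap j.toLinearMap hj
  refine exists_mul_eq_of_sum_eq_isIdempotentElem (p := p)
    (fun _ => isNilpotent_of_map_eq_zero Ω hπ hker) hg ((map_ne_zero_iff _ hinj).2 hf0) hxf hsum
    fun i => ?_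
  obtain ⟨m, t, ht⟩ := exists_pow_expChar_pow_eq_map Ω q hpowK (p (x i))
  obtain ⟨r, hr⟩ := hline t
  have hq : 0 < q ^ m := pow_pos (expChar_pos F q) m
  refine ⟨q ^ m, hq, r, ?_⟩
  calc p (x i) ^ q ^ m = (p (x i) * p g) ^ q ^ m := by rw [← map_mul, hxf]
    _ = p (Algebra.TensorProduct.map (.id Ω Ω) j t) * p g := by
      rw [mul_pow, (hg.map p).pow_eq hq.ne', ht, hcomp]
    _ = r • p g := by rw [← map_mul, ← map_mul, hr, map_smul, map_smul]

variable {N : Type*} [Ring N] [Algebra F N]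

theorem exists_map_centralizer_val_eq {K : Subalgebra F N} {x : Ω ⊗[F] N}
    (hx : ∀ k ∈ K, (1 ⊗ₜ k) * x = x * (1 ⊗ₜ k)) :
    ∃ z, Algebra.TensorProduct.map (.id Ω Ω) (Subalgebra.centralizer F (K : Set N)).val z = x :=
  mem_range_lTensor_subtype (U := (Subalgebra.centralizer F (K : Set N)).toSubmodule) fun φ =>
    (Subalgebra.mem_centralizer_iff F).2 fun k hk => by
      rw [← slice_one_tmul_mul, hx k hk, slice_mul_one_tmul]

variable [FiniteDimensional F N] {K : Subalgebra F N} [IsMulCommutative K]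
open scoped IsMulCommutative

theorem exists_mul_corner_eq (hmax : ∀ y, (∀ k ∈ K, k * y = y * k) → IsSeparable F y → y ∈ K)
    {f : Ω ⊗[F] K} (hf : IsIdempotentElem f) (hf0 : f ≠ 0) (hline : ∀ t, ∃ r : Ω, t * f = r • f)
    {ι : Type*} [Fintype ι] {ε : ι → Ω ⊗[F] N} (hε : ∑ i, ε i = 1) {g : Ω ⊗[F] N}
    (hg : Algebra.TensorProduct.map (.id Ω Ω) K.val f = g) :
    ∃ i w, w * (g * ε i * g) = g := by
  let C := Subalgebra.centralizer F (K : Set N)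
  have hKC : K ≤ C := fun k hk => (Subalgebra.mem_centralizer_iff F).2 fun l hl =>
    congrArg Subtype.val (mul_comm' (⟨l, hl⟩ : K) ⟨k, hk⟩)
  let j : K →ₐ[F] C := Subalgebra.inclusion hKC
  have hcentral (k : K) : j k ∈ Subring.center C := Subring.mem_center_iff.2 fun y =>
    Subtype.ext ((Subalgebra.mem_centralizer_iff F).1 y.2 k k.2).symm
  have hsep (s : C) (hs : IsSeparable F s) : ∃ k, j k = s :=
    ⟨⟨s, hmax s ((Subalgebra.mem_centralizer_iff F).1 s.2) (hs.map C.val Subtype.val_injective)⟩,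
      rfl⟩
  let ζ : Ω ⊗[F] C →ₐ[Ω] Ω ⊗[F] N := Algebra.TensorProduct.map (.id Ω Ω) C.val
  have hζ : Function.Injective ζ :=
    Module.Flat.lTensor_preserves_injective_linearMap C.val.toLinearMap Subtype.val_injective
  have hζg : ζ (Algebra.TensorProduct.map (.id Ω Ω) j f) = g :=
    hg ▸ (DFunLike.congr_fun (Algebra.TensorProduct.map_id_comp C.val j) f).symm
  have hgg : g * g = g := by rw [← hg, ← map_mul, hf.eq]
  have hcorner (i) : ∃ z, ζ z = g * ε i * g := exists_map_centralizer_val_eq fun k hk => by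
    obtain ⟨r, hr⟩ := hline (1 ⊗ₜ ⟨k, hk⟩)
    have hkg : 1 ⊗ₜ k * g = r • g := by
      rw [← hg, ← map_smul, ← hr, map_mul]; rfl
    have hgk : g * 1 ⊗ₜ k = r • g := by
      rw [← hg, ← map_smul, ← hr, mul_comm, map_mul]; rfl
    rw [mul_assoc (g * ε i), hgk, ← mul_assoc, ← mul_assoc, hkg, smul_mul_assoc, smul_mul_assoc,
      mul_smul_comm]
  choose x hx using hcorner
  obtain ⟨i, w, hw⟩ := exists_mul_eq_of_isSeparable_mem_range (Subalgebra.inclusion_injective hKC)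
    hcentral hsep hf hf0 hline (x := x)
    (fun i => hζ (by rw [map_mul, hζg, hx, mul_assoc, hgg]))
    (hζ (by
      rw [map_sum, hζg]
      simp_rw [hx, ← Finset.sum_mul, ← Finset.mul_sum, hε, mul_one, hgg]))
  exact ⟨i, ζ w, by rw [← hx, ← map_mul, hw, hζg]⟩

theorem exists_equivalent_splitIdempotent
    (hmax : ∀ y, (∀ k ∈ K, k * y = y * k) → IsSeparable F y → y ∈ K) {κ : Type*} [DecidableEq κ]
    (e : Ω ⊗[F] K ≃ₐ[Ω] (κ → Ω)) {ι : Type*} [Fintype ι] {ε : ι → Ω ⊗[F] N}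
    (hε : CompleteOrthogonalIdempotents ε) (hpeirce : ∀ i x, ∃ r : Ω, ε i * x * ε i = r • ε i)
    (k : κ) : ∃ i a b, a * b = Algebra.TensorProduct.map (.id Ω Ω) K.val (splitIdempotent e k) ∧
      b * a = ε i := by
  have hidem : IsIdempotentElem (splitIdempotent e k) := isIdempotentElem_splitIdempotent e k
  have hinj : Function.Injective (Algebra.TensorProduct.map (.id Ω Ω) K.val) :=
    Module.Flat.lTensor_preserves_injective_linearMap K.val.toLinearMap Subtype.val_injective
  have h0 := splitIdempotent_ne_zero e k
  obtain ⟨i, w, hw⟩ := exists_mul_corner_eq hmax hidem h0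
    (fun t => ⟨_, mul_splitIdempotent e t k⟩) hε.complete rfl
  exact ⟨i, exists_mul_eq_mul_eq_of_peirce (hε.idem i) (hidem.map _) ((map_ne_zero_iff _ hinj).2 h0)
    (hpeirce i) hw⟩

end Centralizer

section Descent

open scoped IsMulCommutative

theorem exists_smul_one_eq_of_one_tmul_eq_smul_one {F Ω A : Type*} [Field F] [Field Ω]
    [Algebra F Ω] [NonAssocRing A] [Module F A] {a : A} {r : Ω}
    (ha : (1 : Ω) ⊗ₜ[F] a = r • (1 : Ω ⊗[F] A)) : ∃ s : F, s • (1 : A) = a := by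
  obtain ⟨φ, hφ⟩ := LinearMap.exists_leftInverse_of_injective (Algebra.linearMap F Ω)
    (LinearMap.ker_eq_bot.2 (algebraMap F Ω).injective)
  have hφ1 : φ 1 = 1 := by simpa using LinearMap.congr_fun hφ 1
  refine ⟨φ r, ?_⟩
  calc φ r • (1 : A) = slice φ (r • (1 : Ω ⊗[F] A)) := by
        rw [Algebra.TensorProduct.one_def, TensorProduct.smul_tmul', smul_eq_mul, mul_one,
          slice_tmul]
    _ = a := by rw [← ha, slice_tmul, hφ1, one_smul]

variable {F : Type u} [Field F] {A : Type v} [NonAssocRing A] [Module F A]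
  [SMulCommClass F A A] [IsScalarTower F A A]

theorem isSemisimpleRing_tensorProduct_self (F K : Type*) [Field F] [CommRing K] [Algebra F K]
    [Algebra.Etale F K] : IsSemisimpleRing (K ⊗[F] K) := by
  have : FiniteDimensional F K := Algebra.FormallyUnramified.finite_of_free F K
  have : Algebra.Etale F (K ⊗[F] K) := .comp F K (K ⊗[F] K)
  have : IsReduced (K ⊗[F] K) := Algebra.FormallyUnramified.isReduced_of_field F _
  have : IsArtinianRing (K ⊗[F] K) := .of_finite F _
  exact IsArtinianRing.isSemisimpleRing_of_isReduced _

theorem IsSemiassociative.exists_forall_isSkewMatrixAlgebra (h : IsSemiassociative F A) :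
    ∃ (K : Type v) (_ : CommRing K) (_ : Algebra F K), Algebra.Etale F K ∧
      ∀ (Ω : Type w) [Field Ω] [Algebra F Ω], Algebra.IsFiniteSplit Ω (Ω ⊗[F] K) →
        IsSkewMatrixAlgebra Ω (Ω ⊗[F] A) := by
  obtain ⟨-, ⟨_, -⟩, K, _, hK, hmin⟩ := h
  refine ⟨K, inferInstance, inferInstance, hK, fun Ω _ _ hsplit => ?_⟩
  obtain ⟨n, ⟨e⟩⟩ := hsplit.nonempty_algEquiv_fun
  let _ : Module (K ⊗[F] K) A := Module.compHom A (biAction K).toRingHom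
  have := isSemisimpleRing_tensorProduct_self F K
  obtain ⟨a, ha⟩ := IsMinimallyFaithful.exists_bijective hmin
  exact (isFrame_of_biAction_bijective e ha).isSkewMatrixAlgebra

variable {Ω : Type w} [Field Ω] [Algebra F Ω]

theorem IsFrame.isCentralAlgebra_of_baseChange [Nontrivial A] {ι : Type*} [Fintype ι]
    {e : ι → nucleus Ω (Ω ⊗[F] A)} {u : ι → ι → Ω ⊗[F] A} (h : IsFrame e u) :
    IsCentralAlgebra F A := by
  refine ⟨inferInstance, Set.Subset.antisymm (fun a ha => ?_) ?_⟩
  · have hcomm (y : Ω ⊗[F] A) : (1 ⊗ₜ a) * y = y * (1 ⊗ₜ a) := by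
      induction y with
      | zero => rw [mul_zero, zero_mul]
      | add y z hy hz => rw [mul_add, add_mul, hy, hz]
      | tmul ω y =>
        rw [Algebra.TensorProduct.tmul_mul_tmul, Algebra.TensorProduct.tmul_mul_tmul, one_mul,
          mul_one, (ha.comm y).eq]
    obtain ⟨r, hr⟩ := h.exists_eq_smul_one_of_commute _ hcomm
    exact exists_smul_one_eq_of_one_tmul_eq_smul_one hr
  · rintro _ ⟨r, rfl⟩
    refine ⟨fun a => ?_, fun b c => ?_, fun b c => ?_⟩
    · rw [Commute, SemiconjBy, smul_mul_assoc, one_mul, mul_smul_comm, mul_one]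
    · simp only [smul_mul_assoc, one_mul]
    · simp only [mul_smul_comm, mul_one]

theorem isSemiassociative_of_isFrame [Nontrivial A] {K : Subalgebra F (nucleus F A)}
    [IsMulCommutative K] [Algebra.Etale F K] {ι : Type*} [Fintype ι] [DecidableEq ι]
    (e : Ω ⊗[F] K ≃ₐ[Ω] (ι → Ω)) {v : ι → ι → Ω ⊗[F] A} (h : IsFrame (nuclearIdempotent e) v) :
    IsSemiassociative F A := by
  have : FiniteDimensional Ω (Ω ⊗[F] A) := .of_basis h.basis
  have : FiniteDimensional F A := .of_finite_tensorProduct_of_faithfullyFlat Ω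
  refine ⟨inferInstance, h.isCentralAlgebra_of_baseChange, K, inferInstance, inferInstance, ?_⟩
  have : FiniteDimensional F K := Algebra.FormallyUnramified.finite_of_free F K
  let _ : Module (K ⊗[F] K) A := Module.compHom A (biAction K).toRingHom
  have hsmul (t : K ⊗[F] K) (a : A) : t • a = biAction K t a := rfl
  have : IsScalarTower F (K ⊗[F] K) A := ⟨fun r t a => by
    rw [hsmul, hsmul, map_smul, LinearMap.smul_apply]⟩
  have : FaithfulSMul (K ⊗[F] K) A :=
    ⟨fun hst => biAction_injective_of_isFrame e h (LinearMap.ext hst)⟩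
  have := isSemisimpleRing_tensorProduct_self F K
  refine isMinimallyFaithful_of_finrank_eq (F := F) ?_
  rw [Module.finrank_tensorProduct, finrank_eq_card_of_algEquiv e,
    ← Module.finrank_baseChange (R := Ω), h.finrank_eq]

theorem isSemiassociative_of_isSkewMatrixAlgebra [IsSepClosed Ω]
    (h : IsSkewMatrixAlgebra Ω (Ω ⊗[F] A)) : IsSemiassociative F A := by
  obtain ⟨m, hm, ε, u, hε⟩ := h.exists_isFrame
  have : FiniteDimensional Ω (Ω ⊗[F] A) := .of_basis hε.basis
  have : FiniteDimensional F A := .of_finite_tensorProduct_of_faithfullyFlat Ω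
  have : Nontrivial A := by
    by_contra! hA
    exact hε.ne_zero ⟨0, hm⟩ ⟨0, hm⟩ (Subsingleton.elim _ _)
  obtain ⟨K, _, _, hmax⟩ := exists_etale_forall_isSeparable_mem F (nucleus F A)
  have hsplit : Algebra.IsFiniteSplit Ω (Ω ⊗[F] K) := inferInstance
  obtain ⟨n, ⟨e⟩⟩ := hsplit.nonempty_algEquiv_fun
  let ν := nucleusBaseChange F A Ω
  have hpeirce (i) (x : Ω ⊗[F] nucleus F A) :
      ∃ r : Ω, ν.symm (ε i) * x * ν.symm (ε i) = r • ν.symm (ε i) := by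
    obtain ⟨r, hr⟩ := hε.normalize.peirce i i (ν x)
    rw [if_pos rfl, ← nucleus_coe_mul, ← nucleus_coe_mul, ← Submodule.coe_smul] at hr
    refine ⟨r, ν.injective ?_⟩
    rw [map_mul, map_mul, map_smul, ν.apply_symm_apply]
    exact Subtype.ext hr
  choose s a b hab hba using exists_equivalent_splitIdempotent hmax e
    (hε.toCompleteOrthogonalIdempotents.map ν.symm.toRingEquiv.toRingHom) hpeirce
  obtain ⟨v, hv⟩ := hε.exists_of_equivalent (completeOrthogonalIdempotents_nuclearIdempotent e) s
    (ν ∘ a) (ν ∘ b) (fun k => (map_mul ν _ _).symm.trans (congrArg ν (hab k)))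
    (fun k => (map_mul ν _ _).symm.trans
      ((congrArg ν (hba k)).trans (ν.apply_symm_apply _)))
  exact isSemiassociative_of_isFrame e hv

end Descent

section Towers

variable {F : Type u} [Field F] {A : Type v} [NonAssocRing A] [Module F A]
  [SMulCommClass F A A] [IsScalarTower F A A]

theorem IsSkewMatrixAlgebra.of_equiv {B B' : Type*} [NonAssocRing B] [Module F B] [NonAssocRing B']
    [Module F B'] (h : IsSkewMatrixAlgebra F B) (φ : B' ≃ₗ[F] B)
    (hφ : ∀ x y, φ (x * y) = φ x * φ y) : IsSkewMatrixAlgebra F B' := by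
  obtain ⟨n, hn, c, ψ, hψ⟩ := h
  exact ⟨n, hn, c, φ.trans ψ, fun x y => by simp [hφ, hψ]⟩

theorem IsFrame.baseChange (Ω : Type*) [Field Ω] [Algebra F Ω] {ι : Type*} [Fintype ι]
    {e : ι → nucleus F A} {u : ι → ι → A} (h : IsFrame e u) :
    IsFrame (fun i => nucleusBaseChange F A Ω (1 ⊗ₜ e i)) fun i j => 1 ⊗ₜ u i j where
  __ := h.toCompleteOrthogonalIdempotents.map ((nucleusBaseChange F A Ω).toRingEquiv.toRingHom.comp
    Algebra.TensorProduct.includeRight.toRingHom)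
  ne_zero i j := (map_ne_zero_iff _
    (Module.FaithfullyFlat.tensorProduct_mk_injective (A := F) (B := Ω) A)).2 (h.ne_zero i j)
  left_mul i j := by
    rw [coe_nucleusBaseChange_tmul, Algebra.TensorProduct.tmul_mul_tmul, one_mul, h.left_mul]
  mul_right i j := by
    rw [coe_nucleusBaseChange_tmul, Algebra.TensorProduct.tmul_mul_tmul, one_mul, h.mul_right]
  peirce i j x := by
    induction x with
    | zero => exact ⟨0, by rw [mul_zero, zero_mul, zero_smul]⟩
    | add x y hx hy =>
      obtain ⟨r, hr⟩ := hx
      obtain ⟨s, hs⟩ := hy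
      exact ⟨r + s, by rw [mul_add, add_mul, hr, hs, add_smul]⟩
    | tmul ω x =>
      obtain ⟨r, hr⟩ := h.peirce i j x
      refine ⟨r • ω, ?_⟩
      rw [coe_nucleusBaseChange_tmul, coe_nucleusBaseChange_tmul,
        Algebra.TensorProduct.tmul_mul_tmul, Algebra.TensorProduct.tmul_mul_tmul, one_mul, mul_one,
        hr, ← TensorProduct.smul_tmul, TensorProduct.tmul_eq_smul_one_tmul]

theorem IsSkewMatrixAlgebra.baseChange (Ω : Type w) [Field Ω] [Algebra F Ω]
    (h : IsSkewMatrixAlgebra F A) : IsSkewMatrixAlgebra Ω (Ω ⊗[F] A) := by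
  obtain ⟨n, hn, e, u, hframe⟩ := h.exists_isFrame
  have hΩ := hframe.baseChange Ω
  have : Nontrivial (Ω ⊗[F] A) := ⟨_, _, hΩ.ne_zero ⟨0, hn⟩ ⟨0, hn⟩⟩
  exact hΩ.isSkewMatrixAlgebra

theorem cancelBaseChange_mul (E Ω : Type*) [Field E] [Algebra F E] [Field Ω] [Algebra F Ω]
    [Algebra E Ω] [IsScalarTower F E Ω] (x y : Ω ⊗[E] (E ⊗[F] A)) :
    TensorProduct.AlgebraTensorModule.cancelBaseChange F E Ω Ω A (x * y) =
      TensorProduct.AlgebraTensorModule.cancelBaseChange F E Ω Ω A x *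
        TensorProduct.AlgebraTensorModule.cancelBaseChange F E Ω Ω A y := by
  refine LinearMap.congr_fun₂ (f := (LinearMap.mul Ω (Ω ⊗[E] (E ⊗[F] A))).compr₂
    (TensorProduct.AlgebraTensorModule.cancelBaseChange F E Ω Ω A).toLinearMap)
    (g := (LinearMap.mul Ω (Ω ⊗[F] A)).compl₁₂
      (TensorProduct.AlgebraTensorModule.cancelBaseChange F E Ω Ω A).toLinearMap
      (TensorProduct.AlgebraTensorModule.cancelBaseChange F E Ω Ω A).toLinearMap) ?_ x y
  ext a b
  simp

variable {E : Type w} [Field E] [Algebra F E]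

theorem isSemiassociative_of_isSkewMatrixAlgebra_algebraicClosure
    (h : IsSkewMatrixAlgebra (AlgebraicClosure E) (AlgebraicClosure E ⊗[E] (E ⊗[F] A))) :
    IsSemiassociative F A := by
  refine isSemiassociative_of_isSkewMatrixAlgebra (Ω := AlgebraicClosure E) (h.of_equiv
    (TensorProduct.AlgebraTensorModule.cancelBaseChange F E (AlgebraicClosure E)
      (AlgebraicClosure E) A).symm fun x y => ?_)
  rw [LinearEquiv.symm_apply_eq, cancelBaseChange_mul, LinearEquiv.apply_symm_apply,
    LinearEquiv.apply_symm_apply]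

theorem IsSkewMatrixAlgebra.isSemiassociative_of_baseChange
    (h : IsSkewMatrixAlgebra E (E ⊗[F] A)) : IsSemiassociative F A :=
  isSemiassociative_of_isSkewMatrixAlgebra_algebraicClosure (h.baseChange (AlgebraicClosure E))

theorem IsSemiassociative.of_baseChange (h : IsSemiassociative E (E ⊗[F] A)) :
    IsSemiassociative F A := by
  obtain ⟨K, _, _, _, hsplit⟩ := h.exists_forall_isSkewMatrixAlgebra
  exact isSemiassociative_of_isSkewMatrixAlgebra_algebraicClosure (hsplit _ inferInstance)

theorem IsSemiassociative.exists_finite_isSeparable (h : IsSemiassociative F A) :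
    ∃ (E : Type u) (_ : Field E) (_ : Algebra F E), FiniteDimensional F E ∧
      Algebra.IsSeparable F E ∧ IsSkewMatrixAlgebra E (E ⊗[F] A) := by
  obtain ⟨K, _, _, _, hsplit⟩ := h.exists_forall_isSkewMatrixAlgebra
  obtain ⟨E, _, _, hfin, hsep, hE⟩ := exists_field_isFiniteSplit_tensorProduct F K
  exact ⟨E, _, _, hfin, hsep, hsplit E hE⟩

theorem isGeometricallyReduced_of_isSeparable (F E : Type*) [Field F] [Field E] [Algebra F E]
    [FiniteDimensional F E] [Algebra.IsSeparable F E] : Algebra.IsGeometricallyReduced F E := by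
  have : Algebra.FormallyUnramified F E := .of_isSeparable F E
  exact ⟨fun p _ => Algebra.FormallyUnramified.isReduced_of_field
    (AlgebraicClosure p.ResidueField) _⟩

end Towers

end Semiassoc

theorem mainTheorem2_general {F : Type u} [Field F] {A : Type v} [NonAssocRing A] [Module F A]
    [SMulCommClass F A A] [IsScalarTower F A A] :
    (∀ (E : Type w) [Field E] [Algebra F E],
      Semiassoc.IsSemiassociative E (E ⊗[F] A) → Semiassoc.IsSemiassociative F A) ∧
    ∀ P : (E : Type u) → [Field E] → [Algebra F E] → Prop,
      (∀ (E : Type u) [Field E] [Algebra F E],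
        FiniteDimensional F E → Algebra.IsSeparable F E → P E) →
      (Semiassoc.IsSemiassociative F A ↔ ∃ (E : Type u) (_ : Field E) (_ : Algebra F E),
        P E ∧ Semiassoc.IsSkewMatrixAlgebra E (E ⊗[F] A)) := by
  refine ⟨fun E _ _ h => h.of_baseChange, fun P hP => ⟨fun h => ?_, ?_⟩⟩
  · obtain ⟨E, _, _, hfin, hsep, hE⟩ := h.exists_finite_isSeparable
    exact ⟨E, _, _, hP E hfin hsep, hE⟩
  · rintro ⟨E, _, _, -, hE⟩
    exact hE.isSemiassociative_of_baseChange

theorem mainTheorem2 {F : Type u} [Field F] {A : Type v} [NonAssocRing A] [Module F A]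
    [SMulCommClass F A A] [IsScalarTower F A A] :
    -- descent of semiassociativity along separable field extensions, algebraic or not
    (∀ (E : Type w) [Field E] [Algebra F E], Algebra.IsGeometricallyReduced F E →
      Semiassoc.IsSemiassociative E (E ⊗[F] A) → Semiassoc.IsSemiassociative F A) ∧
    -- the semiassociative algebras are the forms of skew matrices
    (Semiassoc.IsSemiassociative F A ↔ Semiassoc.IsFormOfSkewMatrices F A) ∧
    -- the same with separable algebraic extensions, or with finite separable ones
    (Semiassoc.IsSemiassociative F A ↔
      ∃ (E : Type u) (_ : Field E) (_ : Algebra F E),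
        Algebra.IsSeparable F E ∧ Semiassoc.IsSkewMatrixAlgebra E (E ⊗[F] A)) ∧
    (Semiassoc.IsSemiassociative F A ↔
      ∃ (E : Type u) (_ : Field E) (_ : Algebra F E), FiniteDimensional F E ∧
        Algebra.IsSeparable F E ∧ Semiassoc.IsSkewMatrixAlgebra E (E ⊗[F] A)) := by
  obtain ⟨hdescent, hforms⟩ := mainTheorem2_general.{u, v, w} (F := F) (A := A)
  exact ⟨fun E _ _ _ => hdescent E,
    hforms _ fun E _ _ _ _ => Semiassoc.isGeometricallyReduced_of_isSeparable F E,
    hforms _ fun E _ _ _ hsep => hsep,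
    by simpa only [and_assoc] using hforms (fun E _ _ => FiniteDimensional F E ∧
      Algebra.IsSeparable F E) fun E _ _ hfin hsep => ⟨hfin, hsep⟩⟩
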